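/- Let $n\in\mathbb N$ and let $\Phi\in C^2(\mathbb R^n,\mathbb R)$ satisfy $\int_{\mathbb R^n}e^{-\Phi(x)}\,dx=1$; put $d\mu=e^{-\Phi}dx$, $L^2(\mu)=L^2(\mathbb R^n,\mu,\mathbb C)$, and let $(\cdot\,|\,\cdot)_\mu$ (linear in the first entry) denote the inner products of $L^2(\mu)$ and of the spaces $L^2(\mu,\wedge^k\mathbb C^n)$ of $k$-forms with coefficients in $L^2(\mu)$. Let $d_k$ ($k=0,1$) be the exterior derivative, taken in the sense of distributions, as an unbounded operator from $L^2(\mu,\wedge^k\mathbb C^n)$ to $L^2(\mu,\wedge^{k+1}\mathbb C^n)$ with its maximal domain; thus $D(d_0)=H^1(\mu)=\{u\in L^2(\mu): \partial_ju\in L^2(\mu),\ j=1,\dots,n\}$. Let $d_0^*$ be the Hilbert space adjoint of $d_0$ and $X_1=\overline{R(d_0)}$. Let $A_0$ and $A_1$ be the operators in $L^2(\mu)$ and $L^2(\mu,\wedge^1\mathbb C^n)$ defined variationally by the forms $$a_0(u,w)=(d_0u\,|\,d_0w)_\mu\ \text{ on } V_0=D(d_0),\qquad a_1(v,w)=(d_1v\,|\,d_1w)_\mu+(d_0^*v\,|\,d_0^*w)_\mu\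 \text{ on } V_1=D(d_1)\cap D(d_0^*),$$ that is, $u\in D(A_k)$ and $A_ku=f$ if and only if $u\in V_k$ and $a_k(u,w)=(f\,|\,w)_\mu$ for all $w\in V_k$. (They act as $A_0=-\Delta+\Phi'\cdot\nabla$ and $A_1=A_0\otimes I+\Phi''$.) Let $\sigma_{\mathrm{ess}}(A_0)$ be the spectrum of $A_0$ with the isolated eigenvalues of finite multiplicity removed. Suppose that there are a constant $c>0$ and a compact set $K\subset\mathbb R^n$ such that $$\tfrac12|\Phi'(x)|^2-\Delta\Phi(x)\ge c\quad\text{for all } x\in\mathbb R^n\setminus K.$$ Then $0\notin\sigma_{\mathrm{ess}}(A_0)$. Moreover, the range $R(A_0)$ is closed in $L^2(\mu)$, the restriction $A_1|_{X_1}$ of $A_1$ to $D(A_1)\cap X_1$ is injective, and for all $g_1,g_2\in H^1(\mu)$ the form $d_0g_1$ belongs to the range of $A_1|_{X_1}$ and, with $\langle g\rangle=\int g\,d\mu$ and $A_1^{-1}=(A_1|_{X_1})^{-1}$, $$\int_{\mathbb R^n}(g_1-\langle g_1\rangle)\,\overline{(g_2-\langle g_2\rangle)}\,d\mu=(A_1^{-1}d_0g_1\,|\,d_0g_2)_\mu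 .$$ -/

import Mathlib

noncomputable section

namespace WittenComplex

open MeasureTheory
open scoped ContDiff LinearPMap

/-! ### Operators in Hilbert spaces -/

section Operators

variable {H K L : Type*} [NormedAddCommGroup H] [InnerProductSpace ℂ H]
  [NormedAddCommGroup K] [InnerProductSpace ℂ K] [NormedAddCommGroup L] [InnerProductSpace ℂ L]

/-- The resolvent set of an unbounded operator `T`: those `z` for which `T - z`, as a map from
the domain of `T` to `H`, has an everywhere defined bounded two-sided inverse. -/
def resolventSet (T : H →ₗ.[ℂ] H) : Set ℂ :=
  {z | ∃ R : H →L[ℂ] H,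
    (∀ y : H, ∃ h : R y ∈ T.domain, T ⟨R y, h⟩ - z • R y = y) ∧
    ∀ x : T.domain, R (T x - z • (x : H)) = x}

/-- The spectrum of an unbounded operator. -/
def spectrum (T : H →ₗ.[ℂ] H) : Set ℂ := (resolventSet T)ᶜ

/-- The space `Z(T - z)`, as a subspace of the domain of `T`. -/
def eigenspace (T : H →ₗ.[ℂ] H) (z : ℂ) : Submodule ℂ T.domain :=
  LinearMap.ker (T.toFun - z • T.domain.subtype)

/-- The discrete spectrum of a (self-adjoint) operator: the isolated points of the spectrum that
are eigenvalues of finite multiplicity. -/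
def discreteSpectrum (T : H →ₗ.[ℂ] H) : Set ℂ :=
  {z | z ∈ spectrum T ∧ (∃ ε > 0, ∀ w ∈ spectrum T, w ≠ z → ε ≤ ‖w - z‖) ∧
    eigenspace T z ≠ ⊥ ∧ FiniteDimensional ℂ (eigenspace T z)}

/-- The essential spectrum of a (self-adjoint) operator. -/
def essentialSpectrum (T : H →ₗ.[ℂ] H) : Set ℂ := spectrum T \ discreteSpectrum T

/-- The graph of the operator associated with a sesquilinear form `a` on a subspace `V` of `H`:
the pairs `(u, f)` with `u ∈ V` and `a(u, w) = (f | w)` for all `w ∈ V`. Here `(f | w)`, linear in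
`f` and conjugate linear in `w`, is `inner ℂ w f`. -/
def formGraph (V : Submodule ℂ H) (a : V →ₗ[ℂ] V →ₗ⋆[ℂ] ℂ) : Submodule ℂ (H × H) where
  carrier := {p | ∃ h : p.1 ∈ V, ∀ w : V, a ⟨p.1, h⟩ w = inner ℂ (w : H) p.2}
  zero_mem' := ⟨V.zero_mem, fun w => by
    have h0 : (⟨(0 : H × H).1, V.zero_mem⟩ : V) = 0 := rfl
    rw [h0]; simp⟩
  add_mem' := by
    rintro p q ⟨hp, hp'⟩ ⟨hq, hq'⟩
    refine ⟨V.add_mem hp hq, fun w => ?_⟩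
    have h0 : (⟨(p + q).1, V.add_mem hp hq⟩ : V) = ⟨p.1, hp⟩ + ⟨q.1, hq⟩ := rfl
    rw [h0, map_add, LinearMap.add_apply, hp', hq', Prod.snd_add, inner_add_right]
  smul_mem' := by
    rintro c p ⟨hp, hp'⟩
    refine ⟨V.smul_mem c hp, fun w => ?_⟩
    have h0 : (⟨(c • p).1, V.smul_mem c hp⟩ : V) = c • ⟨p.1, hp⟩ := rfl
    rw [h0, map_smul, LinearMap.smul_apply, hp', Prod.smul_snd, inner_smul_right, smul_eq_mul]

/-- The operator associated with a sesquilinear form `a` on a dense subspace `V` of `H`. -/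
def formOperator (V : Submodule ℂ H) (a : V →ₗ[ℂ] V →ₗ⋆[ℂ] ℂ) : H →ₗ.[ℂ] H :=
  (formGraph V a).toLinearPMap

/-- The sesquilinear form `(u, w) ↦ (T u | T w)` on the domain of `T`. -/
def energyForm (T : H →ₗ.[ℂ] K) : T.domain →ₗ[ℂ] T.domain →ₗ⋆[ℂ] ℂ :=
  LinearMap.mk₂'ₛₗ (RingHom.id ℂ) (starRingEnd ℂ) (fun u w => inner ℂ (T w) (T u))
    (fun u₁ u₂ w => by rw [LinearPMap.map_add, inner_add_right])
    (fun c u w => by rw [LinearPMap.map_smul, inner_smul_right]; rfl)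
    (fun u w₁ w₂ => by rw [LinearPMap.map_add, inner_add_left])
    (fun c u w => by rw [LinearPMap.map_smul, inner_smul_left]; rfl)

/-- The sesquilinear form `(v, w) ↦ (T v | T w) + (S v | S w)` on `D(T) ∩ D(S)`. -/
def energyFormPair (T : H →ₗ.[ℂ] K) (S : H →ₗ.[ℂ] L) :
    ↥(T.domain ⊓ S.domain) →ₗ[ℂ] ↥(T.domain ⊓ S.domain) →ₗ⋆[ℂ] ℂ :=
  LinearMap.mk₂'ₛₗ (RingHom.id ℂ) (starRingEnd ℂ)
    (fun v w => energyForm T ⟨v, v.2.1⟩ ⟨w, w.2.1⟩ + energyForm S ⟨v, v.2.2⟩ ⟨w, w.2.2⟩)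
    (fun v₁ v₂ w => by
      have h1 : (⟨((v₁ + v₂ : ↥(T.domain ⊓ S.domain)) : H), (v₁ + v₂).2.1⟩ : T.domain)
        = ⟨v₁, v₁.2.1⟩ + ⟨v₂, v₂.2.1⟩ := rfl
      have h2 : (⟨((v₁ + v₂ : ↥(T.domain ⊓ S.domain)) : H), (v₁ + v₂).2.2⟩ : S.domain)
        = ⟨v₁, v₁.2.2⟩ + ⟨v₂, v₂.2.2⟩ := rfl
      rw [h1, h2, map_add, map_add, LinearMap.add_apply, LinearMap.add_apply]; ring)
    (fun c v w => by
      have h1 : (⟨((c • v : ↥(T.domain ⊓ S.domain)) : H), (c • v).2.1⟩ : T.domain)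
        = c • ⟨v, v.2.1⟩ := rfl
      have h2 : (⟨((c • v : ↥(T.domain ⊓ S.domain)) : H), (c • v).2.2⟩ : S.domain)
        = c • ⟨v, v.2.2⟩ := rfl
      rw [h1, h2, map_smul, map_smul, LinearMap.smul_apply, LinearMap.smul_apply, ← smul_add]; rfl)
    (fun v w₁ w₂ => by
      have h1 : (⟨((w₁ + w₂ : ↥(T.domain ⊓ S.domain)) : H), (w₁ + w₂).2.1⟩ : T.domain)
        = ⟨w₁, w₁.2.1⟩ + ⟨w₂, w₂.2.1⟩ := rfl
      have h2 : (⟨((w₁ + w₂ : ↥(T.domain ⊓ S.domain)) : H), (w₁ + w₂).2.2⟩ : S.domain)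
        = ⟨w₁, w₁.2.2⟩ + ⟨w₂, w₂.2.2⟩ := rfl
      rw [h1, h2, map_add, map_add]; ring)
    (fun c v w => by
      have h1 : (⟨((c • w : ↥(T.domain ⊓ S.domain)) : H), (c • w).2.1⟩ : T.domain)
        = c • ⟨w, w.2.1⟩ := rfl
      have h2 : (⟨((c • w : ↥(T.domain ⊓ S.domain)) : H), (c • w).2.2⟩ : S.domain)
        = c • ⟨w, w.2.2⟩ := rfl
      rw [h1, h2, LinearMap.map_smulₛₗ, LinearMap.map_smulₛₗ, ← smul_add])

end Operators

/-! ### The weighted spaces -/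

/-- Euclidean space `ℝⁿ`. -/
abbrev E (n : ℕ) := EuclideanSpace ℝ (Fin n)

variable {n : ℕ}

/-- The measure `dμ = e^{-Φ} dx`. -/
def gibbs (Φ : E n → ℝ) : Measure (E n) :=
  volume.withDensity fun x => ENNReal.ofReal (Real.exp (-Φ x))

/-- `L²(μ)`, the functions (0-forms). -/
abbrev Forms₀ (Φ : E n → ℝ) := Lp ℂ 2 (gibbs Φ)

/-- `L²(μ, ∧¹ℂⁿ)`: a 1-form `∑ v_j dz^j` is its vector of coefficients. -/
abbrev Forms₁ (Φ : E n → ℝ) := Lp (EuclideanSpace ℂ (Fin n)) 2 (gibbs Φ)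

/-- `L²(μ, ∧²ℂⁿ)`: a 2-form `∑_{j<l} w_{jl} dz^j ∧ dz^l` is its family of coefficients. -/
abbrev Forms₂ (Φ : E n → ℝ) :=
  Lp (EuclideanSpace ℂ {p : Fin n × Fin n // p.1 < p.2}) 2 (gibbs Φ)

lemma locallyIntegrable_coeFn {F : Type*} [NormedAddCommGroup F] [NormedSpace ℝ F]
    {Φ : E n → ℝ} (hΦ : Continuous Φ) (f : Lp F 2 (gibbs Φ)) :
    LocallyIntegrable (f : E n → F) volume := by
  have hc : Continuous fun x => Real.exp (-Φ x) := by fun_prop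
  have : IsLocallyFiniteMeasure (gibbs Φ) := IsLocallyFiniteMeasure.withDensity_ofReal hc
  have h1 : LocallyIntegrable (f : E n → F) (gibbs Φ) :=
    (Lp.memLp f).locallyIntegrable (by norm_num)
  have hae : (gibbs Φ) = volume.withDensity fun x => ((Real.exp (-Φ x)).toNNReal : ENNReal) := rfl
  generalize (f : E n → F) = g at h1 ⊢
  rw [locallyIntegrable_iff] at h1 ⊢
  intro k hk
  have h3 := h1 k hk
  rw [IntegrableOn, hae, restrict_withDensity hk.measurableSet,
    integrable_withDensity_iff_integrable_smul (by fun_prop)] at h3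
  have h2 : IntegrableOn (fun x => Real.exp (-Φ x) • g x) k volume := by
    refine h3.congr (Filter.Eventually.of_forall fun x => ?_)
    simp only [NNReal.smul_def, Real.coe_toNNReal _ (Real.exp_pos _).le]
  have h4 : IntegrableOn (fun x => Real.exp (Φ x) • Real.exp (-Φ x) • g x) k volume :=
    h2.continuousOn_smul (f := fun x => Real.exp (Φ x)) (by fun_prop) hk
  refine h4.congr_fun (fun x _ => ?_) hk.measurableSet
  simp only [smul_smul, ← Real.exp_add]
  simp

lemma ae_volume_of_ae_gibbs {Φ : E n → ℝ} (hΦ : Continuous Φ) {p : E n → Prop}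
    (h : ∀ᵐ x ∂(gibbs Φ), p x) : ∀ᵐ x, p x := by
  refine (withDensity_absolutelyContinuous' (by fun_prop) ?_).ae_le h
  exact Filter.Eventually.of_forall fun x => by simp [Real.exp_pos]

/-! ### The exterior derivatives -/

/-- The partial derivative `∂_j φ`. -/
def partialDeriv (j : Fin n) (φ : E n → ℝ) (x : E n) : ℝ :=
  fderiv ℝ φ x (EuclideanSpace.single j 1)

/-- The pairing `⟨f, ψ⟩ = ∫ f ψ dx` of a locally integrable function with a continuous function
of compact support (with respect to Lebesgue measure). -/
def pairing (f : E n → ℂ) (ψ : E n → ℝ) : ℂ := ∫ x, ψ x • f x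

lemma pairing_add {F : Type*} [NormedAddCommGroup F] [NormedSpace ℂ F] {Φ : E n → ℝ}
    (hΦ : Continuous Φ) (ℓ : F →L[ℂ] ℂ) {ψ : E n → ℝ} (hψ : Continuous ψ)
    (hs : HasCompactSupport ψ) (f g : Lp F 2 (gibbs Φ)) :
    pairing (fun x => ℓ ((f + g : Lp F 2 (gibbs Φ)) x)) ψ =
      pairing (fun x => ℓ (f x)) ψ + pairing (fun x => ℓ (g x)) ψ := by
  let _ : NormedSpace ℝ F := NormedSpace.restrictScalars ℝ ℂ F
  have hi : ∀ f : Lp F 2 (gibbs Φ), Integrable (fun x => ψ x • ℓ (f x)) volume := fun f => by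
    have h := ((locallyIntegrable_coeFn hΦ f).integrable_smul_left_of_hasCompactSupport hψ hs)
    refine ((ℓ.restrictScalars ℝ).integrable_comp h).congr (Filter.Eventually.of_forall fun x => ?_)
    exact (ℓ.restrictScalars ℝ).map_smul (ψ x) (f x)
  unfold pairing
  rw [← integral_add (hi f) (hi g)]
  refine integral_congr_ae ?_
  filter_upwards [ae_volume_of_ae_gibbs hΦ (Lp.coeFn_add f g)] with x hx
  rw [hx, Pi.add_apply, map_add, smul_add]

lemma pairing_smul {F : Type*} [NormedAddCommGroup F] [NormedSpace ℂ F] {Φ : E n → ℝ}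
    (hΦ : Continuous Φ) (ℓ : F →L[ℂ] ℂ) (ψ : E n → ℝ) (c : ℂ) (f : Lp F 2 (gibbs Φ)) :
    pairing (fun x => ℓ ((c • f : Lp F 2 (gibbs Φ)) x)) ψ = c * pairing (fun x => ℓ (f x)) ψ := by
  unfold pairing
  rw [← smul_eq_mul, ← integral_smul]
  refine integral_congr_ae ?_
  filter_upwards [ae_volume_of_ae_gibbs hΦ (Lp.coeFn_smul c f)] with x hx
  rw [hx, Pi.smul_apply, map_smul, smul_comm]

lemma pairing_zero {F : Type*} [NormedAddCommGroup F] [NormedSpace ℂ F] {Φ : E n → ℝ}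
    (hΦ : Continuous Φ) (ℓ : F →L[ℂ] ℂ) (ψ : E n → ℝ) :
    pairing (fun x => ℓ ((0 : Lp F 2 (gibbs Φ)) x)) ψ = 0 := by
  have h := pairing_smul hΦ ℓ ψ 0 0
  rwa [zero_smul, zero_mul] at h

lemma continuous_partialDeriv {φ : E n → ℝ} (hφ : ContDiff ℝ ∞ φ) (j : Fin n) :
    Continuous (partialDeriv j φ) :=
  (hφ.continuous_fderiv (by simp)).clm_apply continuous_const

lemma hasCompactSupport_partialDeriv {φ : E n → ℝ} (hs : HasCompactSupport φ) (j : Fin n) :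
    HasCompactSupport (partialDeriv j φ) :=
  hs.fderiv_apply ℝ _

/-- The graph of `d₀`: the pairs `(u, v)` in `L²(μ) × L²(μ, ∧¹ℂⁿ)` with `∂_j u = v_j` in the sense
of distributions on `ℝⁿ`, for every `j`. -/
def d₀Graph (Φ : E n → ℝ) (hΦ : Continuous Φ) : Submodule ℂ (Forms₀ Φ × Forms₁ Φ) where
  carrier := {p | ∀ (j : Fin n) (φ : E n → ℝ), ContDiff ℝ ∞ φ → HasCompactSupport φ →
    pairing (fun x => p.1 x) (partialDeriv j φ) = -pairing (fun x => p.2 x j) φ}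
  zero_mem' := fun j φ _ _ => by
    have h1 := pairing_zero hΦ (ContinuousLinearMap.id ℂ ℂ) (partialDeriv j φ)
    have h2 := pairing_zero hΦ (EuclideanSpace.proj j : EuclideanSpace ℂ (Fin n) →L[ℂ] ℂ) φ
    exact h1.trans (by rw [← neg_zero, ← h2]; rfl)
  add_mem' := fun {p q} hp hq j φ hφ hs => by
    have h1 := pairing_add hΦ (ContinuousLinearMap.id ℂ ℂ) (continuous_partialDeriv hφ j)
      (hasCompactSupport_partialDeriv hs j) p.1 q.1
    have h2 := pairing_add hΦ (EuclideanSpace.proj j : EuclideanSpace ℂ (Fin n) →L[ℂ] ℂ)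
      hφ.continuous hs p.2 q.2
    refine h1.trans (Eq.trans ?_ (congrArg Neg.neg h2.symm))
    exact (congrArg₂ (· + ·) (hp j φ hφ hs) (hq j φ hφ hs)).trans (neg_add _ _).symm
  smul_mem' := fun c p hp j φ hφ hs => by
    have h1 := pairing_smul hΦ (ContinuousLinearMap.id ℂ ℂ) (partialDeriv j φ) c p.1
    have h2 := pairing_smul hΦ (EuclideanSpace.proj j : EuclideanSpace ℂ (Fin n) →L[ℂ] ℂ) φ c p.2
    refine h1.trans (Eq.trans ?_ (congrArg Neg.neg h2.symm))
    exact (congrArg (c * ·) (hp j φ hφ hs)).trans (mul_neg _ _)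

/-- The graph of `d₁`: the pairs `(v, w)` in `L²(μ, ∧¹ℂⁿ) × L²(μ, ∧²ℂⁿ)` with
`∂_j v_l - ∂_l v_j = w_{jl}` in the sense of distributions on `ℝⁿ`, for all `j < l`. -/
def d₁Graph (Φ : E n → ℝ) (hΦ : Continuous Φ) : Submodule ℂ (Forms₁ Φ × Forms₂ Φ) where
  carrier := {p | ∀ (J : {p : Fin n × Fin n // p.1 < p.2}) (φ : E n → ℝ),
    ContDiff ℝ ∞ φ → HasCompactSupport φ →
    pairing (fun x => p.1 x J.1.2) (partialDeriv J.1.1 φ) -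
      pairing (fun x => p.1 x J.1.1) (partialDeriv J.1.2 φ) = -pairing (fun x => p.2 x J) φ}
  zero_mem' := fun J φ _ _ => by
    have h1 := fun j l => pairing_zero hΦ
      (EuclideanSpace.proj l : EuclideanSpace ℂ (Fin n) →L[ℂ] ℂ) (partialDeriv j φ)
    have h2 := pairing_zero hΦ (EuclideanSpace.proj J :
      EuclideanSpace ℂ {p : Fin n × Fin n // p.1 < p.2} →L[ℂ] ℂ) φ
    refine (congrArg₂ (· - ·) (h1 J.1.1 J.1.2) (h1 J.1.2 J.1.1)).trans ?_
    refine Eq.trans ?_ (congrArg Neg.neg h2.symm)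
    simp
  add_mem' := fun {p q} hp hq J φ hφ hs => by
    have h1 := fun j l => pairing_add hΦ
      (EuclideanSpace.proj l : EuclideanSpace ℂ (Fin n) →L[ℂ] ℂ) (continuous_partialDeriv hφ j)
      (hasCompactSupport_partialDeriv hs j) p.1 q.1
    have h2 := pairing_add hΦ (EuclideanSpace.proj J :
      EuclideanSpace ℂ {p : Fin n × Fin n // p.1 < p.2} →L[ℂ] ℂ) hφ.continuous hs p.2 q.2
    refine (congrArg₂ (· - ·) (h1 J.1.1 J.1.2) (h1 J.1.2 J.1.1)).trans ?_
    refine Eq.trans ?_ (congrArg Neg.neg h2.symm)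
    refine (add_sub_add_comm _ _ _ _).trans ?_
    exact (congrArg₂ (· + ·) (hp J φ hφ hs) (hq J φ hφ hs)).trans (neg_add _ _).symm
  smul_mem' := fun c p hp J φ hφ hs => by
    have h1 := fun j l => pairing_smul hΦ
      (EuclideanSpace.proj l : EuclideanSpace ℂ (Fin n) →L[ℂ] ℂ) (partialDeriv j φ) c p.1
    have h2 := pairing_smul hΦ (EuclideanSpace.proj J :
      EuclideanSpace ℂ {p : Fin n × Fin n // p.1 < p.2} →L[ℂ] ℂ) φ c p.2
    refine (congrArg₂ (· - ·) (h1 J.1.1 J.1.2) (h1 J.1.2 J.1.1)).trans ?_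
    refine Eq.trans ?_ (congrArg Neg.neg h2.symm)
    refine (mul_sub _ _ _).symm.trans ?_
    exact (congrArg (c * ·) (hp J φ hφ hs)).trans (mul_neg _ _)

lemma ae_zero_of_pairing {ι : Type*} [Fintype ι] {Φ : E n → ℝ} (hΦ : Continuous Φ)
    (w : Lp (EuclideanSpace ℂ ι) 2 (gibbs Φ))
    (h : ∀ (i : ι) (φ : E n → ℝ), ContDiff ℝ ∞ φ → HasCompactSupport φ →
      pairing (fun x => w x i) φ = 0) : w = 0 := by
  have h1 : ∀ i, ∀ᵐ x ∂(gibbs Φ), w x i = 0 := fun i => by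
    have hl : LocallyIntegrable (fun x => w x i) volume := by
      have h2 := locallyIntegrable_coeFn hΦ w
      rw [locallyIntegrable_iff] at h2 ⊢
      intro k hk
      exact ((EuclideanSpace.proj i : EuclideanSpace ℂ ι →L[ℂ] ℂ).restrictScalars ℝ).integrable_comp
        (h2 k hk)
    exact (withDensity_absolutelyContinuous _ _).ae_le
      (ae_eq_zero_of_integral_contDiff_smul_eq_zero hl (h i))
  rw [Lp.eq_zero_iff_ae_eq_zero]
  filter_upwards [Filter.eventually_all.2 h1] with x hx
  ext i
  exact hx i

/-- Weak gradients are unique, so `d₀Graph` is the graph of an operator. -/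
lemma d₀Graph_singleValued {Φ : E n → ℝ} (hΦ : Continuous Φ) (p : Forms₀ Φ × Forms₁ Φ)
    (hp : p ∈ d₀Graph Φ hΦ) (h0 : p.1 = 0) : p.2 = 0 := by
  refine ae_zero_of_pairing hΦ _ fun j φ hφ hs => ?_
  have h1 := hp j φ hφ hs
  rw [h0] at h1
  have h2 := pairing_zero hΦ (ContinuousLinearMap.id ℂ ℂ) (partialDeriv j φ)
  exact neg_eq_zero.1 (h1.symm.trans h2)

/-- Weak exterior derivatives are unique, so `d₁Graph` is the graph of an operator. -/
lemma d₁Graph_singleValued {Φ : E n → ℝ} (hΦ : Continuous Φ) (p : Forms₁ Φ × Forms₂ Φ)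
    (hp : p ∈ d₁Graph Φ hΦ) (h0 : p.1 = 0) : p.2 = 0 := by
  refine ae_zero_of_pairing hΦ _ fun J φ hφ hs => ?_
  have h1 := hp J φ hφ hs
  rw [h0] at h1
  have h2 := fun j l => pairing_zero hΦ
    (EuclideanSpace.proj l : EuclideanSpace ℂ (Fin n) →L[ℂ] ℂ) (partialDeriv j φ)
  refine neg_eq_zero.1 (h1.symm.trans ?_)
  exact (congrArg₂ (· - ·) (h2 J.1.1 J.1.2) (h2 J.1.2 J.1.1)).trans (sub_zero _)

/-- The exterior derivative `d₀` from `L²(μ)` to `L²(μ, ∧¹ℂⁿ)` with its maximal domain; this domain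
is the weighted Sobolev space `H¹(μ)`. -/
def d₀ (Φ : E n → ℝ) (hΦ : Continuous Φ) : Forms₀ Φ →ₗ.[ℂ] Forms₁ Φ :=
  (d₀Graph Φ hΦ).toLinearPMap

/-- The exterior derivative `d₁` from `L²(μ, ∧¹ℂⁿ)` to `L²(μ, ∧²ℂⁿ)` with its maximal domain. -/
def d₁ (Φ : E n → ℝ) (hΦ : Continuous Φ) : Forms₁ Φ →ₗ.[ℂ] Forms₂ Φ :=
  (d₁Graph Φ hΦ).toLinearPMap

/-- The closure `X₁` of the range of `d₀` in `L²(μ, ∧¹ℂⁿ)`. -/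
def X₁ (Φ : E n → ℝ) (hΦ : Continuous Φ) : Submodule ℂ (Forms₁ Φ) :=
  (LinearMap.range (d₀ Φ hΦ).toFun).topologicalClosure

/-! ### The operators `A₀` and `A₁` -/

/-- `A₀`, the operator in `L²(μ)` associated with the form `a₀(u, w) = (d₀ u | d₀ w)_μ` on
`V₀ = D(d₀) = H¹(μ)`. -/
def A₀ (Φ : E n → ℝ) (hΦ : Continuous Φ) : Forms₀ Φ →ₗ.[ℂ] Forms₀ Φ :=
  formOperator (d₀ Φ hΦ).domain (energyForm (d₀ Φ hΦ))

/-- `A₁`, the operator in `L²(μ, ∧¹ℂⁿ)` associated with the form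
`a₁(v, w) = (d₁ v | d₁ w)_μ + (d₀* v | d₀* w)_μ` on `V₁ = D(d₁) ∩ D(d₀*)`, where `d₀*` is the
Hilbert space adjoint of `d₀`. -/
def A₁ (Φ : E n → ℝ) (hΦ : Continuous Φ) : Forms₁ Φ →ₗ.[ℂ] Forms₁ Φ :=
  formOperator ((d₁ Φ hΦ).domain ⊓ (d₀ Φ hΦ)†.domain) (energyFormPair (d₁ Φ hΦ) (d₀ Φ hΦ)†)

/-- The restriction of `A₁` to `D(A₁) ∩ X₁`. -/
def A₁X (Φ : E n → ℝ) (hΦ : Continuous Φ) : Forms₁ Φ →ₗ.[ℂ] Forms₁ Φ :=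
  (A₁ Φ hΦ).domRestrict (X₁ Φ hΦ)

/-- The mean `⟨g⟩ = ∫ g dμ`. -/
def mean (Φ : E n → ℝ) (g : Forms₀ Φ) : ℂ := ∫ x, g x ∂(gibbs Φ)

/-- The covariance `∫ (g₁ - ⟨g₁⟩) conj (g₂ - ⟨g₂⟩) dμ`. -/
def cov (Φ : E n → ℝ) (g₁ g₂ : Forms₀ Φ) : ℂ :=
  ∫ x, (g₁ x - mean Φ g₁) * starRingEnd ℂ (g₂ x - mean Φ g₂) ∂(gibbs Φ)

end WittenComplex

end

noncomputable section

namespace WittenComplex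

open MeasureTheory
open scoped ContDiff LinearPMap

/-! ### Operators defined by forms, and the Green operator of `T* T` -/

section Abstract

variable {H K L : Type*} [NormedAddCommGroup H] [InnerProductSpace ℂ H]
  [NormedAddCommGroup K] [InnerProductSpace ℂ K] [NormedAddCommGroup L] [InnerProductSpace ℂ L]

/-! Everything follows from one Poincaré inequality, `‖u - ⟨u⟩‖ ≤ C ‖d₀ u‖` on `H¹(μ)`
(`exists_poincare`), and Hilbert space arguments for a closed, densely defined `T` (here `d₀`) that
kills a unit vector `e` (here the constant `1`).

Abstract part. The inequality gives `T` a bounded inverse `B` from its closed range to the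
orthogonal complement of `e`, and `G = B B*` inverts `T* T` there (`exists_green`). Hence the range
of `T* T` is the orthogonal complement of `e`, its kernel is the line of `e`, and a Neumann series
in `G` gives the resolvent at all small `z ≠ 0`, so `0` is an isolated eigenvalue of finite
multiplicity. If moreover `S T = 0`, then `v = T G g₁` lies in the range of `T` and satisfies `S v =
0` and `T* v = g₁ - (g₁ | e) e`. Thus `A₁ v = T g₁`, and `(v | T g₂) = (T G g₁ | T g₂)` is the
covariance (`inner_inverse_pairOperator`). Injectivity of `A₁` on `X₁` needs no spectral gap: `A₁ v
= 0` forces `T* v = 0`, so `v` is orthogonal to the closed range that contains it.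

Poincaré inequality. For test functions, integrating `|∇f - f ∇Φ / 2|² ≥ 0` against `μ` by parts
gives `∫ (|Φ'|² / 4 - ΔΦ / 2) |f|² dμ ≤ ∫ |∇f|² dμ` (`integral_schrodingerPotential_mul_le`). The
potential is at least `c / 2` off a ball, so only `∫ |f|² dμ` over that ball remains to be
controlled. There the weight is bounded above and below, and the Poincaré inequality on a ball
applies (`exists_integral_ball_norm_sq_le`). The resulting bound, with the integral of `f` over the
ball as remainder, extends to `H¹(μ)` by density of test functions (`exists_smooth_approx`), and
subtracting a suitable constant removes the remainder. -/

lemma formGraph_singleValued {V : Submodule ℂ H} (hV : Dense (V : Set H))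
    (a : V →ₗ[ℂ] V →ₗ⋆[ℂ] ℂ) (p : H × H) (hp : p ∈ formGraph V a) (h0 : p.1 = 0) : p.2 = 0 := by
  obtain ⟨h, hw⟩ := hp
  have h1 : (⟨p.1, h⟩ : V) = 0 := Subtype.ext h0
  refine hV.eq_zero_of_inner_right (𝕜 := ℂ) fun v hv => ?_
  have h2 := hw ⟨v, hv⟩
  rw [h1, map_zero, LinearMap.zero_apply] at h2
  exact h2.symm

lemma formOperator_graph {V : Submodule ℂ H} (hV : Dense (V : Set H))
    (a : V →ₗ[ℂ] V →ₗ⋆[ℂ] ℂ) : (formOperator V a).graph = formGraph V a :=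
  Submodule.toLinearPMap_graph_eq _ (formGraph_singleValued hV a)

lemma formOperator_spec {V : Submodule ℂ H} (hV : Dense (V : Set H))
    (a : V →ₗ[ℂ] V →ₗ⋆[ℂ] ℂ) (u : (formOperator V a).domain) :
    ∃ h : (u : H) ∈ V, ∀ w : V, a ⟨u, h⟩ w = inner ℂ (w : H) (formOperator V a u) := by
  have h := (formOperator V a).mem_graph u
  rw [formOperator_graph hV] at h
  exact h

lemma formOperator_of_mem_formGraph {V : Submodule ℂ H} (hV : Dense (V : Set H))
    (a : V →ₗ[ℂ] V →ₗ⋆[ℂ] ℂ) {u f : H} (h : (u, f) ∈ formGraph V a) :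
    ∃ h : u ∈ (formOperator V a).domain, formOperator V a ⟨u, h⟩ = f := by
  rw [← formOperator_graph hV, LinearPMap.mem_graph_iff] at h
  obtain ⟨y, rfl, hy⟩ := h
  exact ⟨y.2, hy⟩

/-- The Green operator of `T* T`: if `T` is closed and satisfies a Poincaré inequality modulo the
unit vector `e`, then `T* T u = f - (f | e) e` has a solution `u ⊥ e` that depends continuously
on `f`. -/
lemma exists_green [CompleteSpace H] [CompleteSpace K] (T : H →ₗ.[ℂ] K)
    (hTc : IsClosed (T.graph : Set (H × K))) (e : H) (he1 : ‖e‖ = 1) (he : (e, (0 : K)) ∈ T.graph)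
    (C : ℝ) (hP : ∀ u : T.domain, ‖(u : H) - inner ℂ e (u : H) • e‖ ≤ C * ‖T u‖) :
    ∃ G : H →L[ℂ] H, ∀ f, inner ℂ e (G f) = 0 ∧ ∃ h : G f ∈ T.domain,
      ∀ w : T.domain, inner ℂ (T w) (T ⟨G f, h⟩) = inner ℂ (w : H) (f - inner ℂ e f • e) := by
  obtain ⟨⟨e', heD⟩, rfl, hTe⟩ := (LinearPMap.mem_graph_iff _).1 he
  simp only at he1 he hP hTe
  set e := e'
  have hee : inner ℂ e e = 1 := by rw [inner_self_eq_norm_sq_to_K, he1]; simp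
  let ℓ : H × K →L[ℂ] ℂ := (innerSL ℂ e).comp (ContinuousLinearMap.fst ℂ H K)
  -- The graph of `T` restricted to the orthogonal complement of `e`. The Poincaré inequality says
  -- that the projection `s` to `K` is bounded below on it, so `s` is injective with closed range.
  let g : Submodule ℂ (H × K) := T.graph ⊓ LinearMap.ker ℓ.toLinearMap
  have hgc : IsClosed (g : Set (H × K)) := hTc.inter ℓ.isClosed_ker
  have : CompleteSpace g := hgc.completeSpace_coe
  let s : g →L[ℂ] K := (ContinuousLinearMap.snd ℂ H K).comp g.subtypeL
  have hbound : ∀ x : g, ‖(x : H × K).1‖ ≤ C * ‖s x‖ := by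
    rintro ⟨⟨u, v⟩, hx, hx'⟩
    obtain ⟨y, hy1, hy2⟩ := (LinearPMap.mem_graph_iff _).1 hx
    simp only at hy1 hy2
    subst hy1 hy2
    have h1 := hP y
    have h2 : inner ℂ e (y : H) = 0 := hx'
    rw [h2, zero_smul, sub_zero] at h1
    exact h1
  -- The norm of `H × K` is a maximum: `C` controls the first component and `1` the second.
  have hanti : AntilipschitzWith (Real.toNNReal (max C 1)) s := by
    refine ContinuousLinearMap.antilipschitz_of_bound s fun x => ?_
    rw [Real.coe_toNNReal _ (le_max_of_le_right zero_le_one)]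
    refine (Prod.norm_def (x : H × K)).le.trans (max_le ?_ ?_)
    · exact (hbound x).trans (by gcongr; exact le_max_left _ _)
    · calc ‖(x : H × K).2‖ = 1 * ‖s x‖ := (one_mul _).symm
        _ ≤ _ := by gcongr; exact le_max_right _ _
  have hclo : IsClosed (Set.range s) := hanti.isClosed_range s.uniformContinuous
  let q := s.equivRange hanti.injective hclo
  have : CompleteSpace (LinearMap.range s.toLinearMap) :=
    IsClosed.completeSpace_coe (s := (LinearMap.range s.toLinearMap : Set K)) (hs := hclo)
  -- `B` sends `T u` to the component of `u` orthogonal to `e`.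
  let B : LinearMap.range s.toLinearMap →L[ℂ] H :=
    ((ContinuousLinearMap.fst ℂ H K).comp g.subtypeL).comp q.symm.toContinuousLinearMap
  have hBs : ∀ x : g, B ⟨s x, x, rfl⟩ = (x : H × K).1 := fun x => by
    have : q.symm ⟨s x, x, rfl⟩ = x := by
      rw [ContinuousLinearEquiv.symm_apply_eq]; rfl
    change ((q.symm ⟨s x, x, rfl⟩ : g) : H × K).1 = _
    rw [this]
  have hmem : ∀ w : T.domain, ((w : H) - inner ℂ e (w : H) • e, T w) ∈ g := fun w => by
    refine ⟨?_, ?_⟩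
    · have h := T.graph.sub_mem (T.mem_graph w) (T.graph.smul_mem (inner ℂ e (w : H)) he)
      simpa using h
    · change inner ℂ e ((w : H) - inner ℂ e (w : H) • e) = 0
      rw [inner_sub_right, inner_smul_right, hee, mul_one, sub_self]
  have hBT : ∀ w : T.domain, ∃ h : T w ∈ LinearMap.range s.toLinearMap,
      B ⟨T w, h⟩ = (w : H) - inner ℂ e (w : H) • e :=
    fun w => ⟨⟨⟨_, hmem w⟩, rfl⟩, hBs ⟨_, hmem w⟩⟩
  -- Take `G = B B*`. Since `T B` is the identity on the range of `T`, `(T G f | T w) = (B* f | T w)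
  -- = (f | B T w)`, and `B T w = w - (w | e) e`.
  refine ⟨B.comp (ContinuousLinearMap.adjoint B), fun f => ?_⟩
  obtain ⟨x, hx⟩ := (ContinuousLinearMap.adjoint B f).2
  have hx' : ContinuousLinearMap.adjoint B f = ⟨s x, x, rfl⟩ := Subtype.ext hx.symm
  have hG : (B.comp (ContinuousLinearMap.adjoint B)) f = (x : H × K).1 := by
    rw [ContinuousLinearMap.comp_apply, hx', hBs]
  rw [hG]
  refine ⟨x.2.2, ?_⟩
  obtain ⟨y, hy1, hy2⟩ := (LinearPMap.mem_graph_iff _).1 x.2.1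
  refine ⟨hy1 ▸ y.2, fun w => ?_⟩
  have hT : T ⟨(x : H × K).1, hy1 ▸ y.2⟩ = s x := by
    rw [show (⟨(x : H × K).1, hy1 ▸ y.2⟩ : T.domain) = y from Subtype.ext hy1.symm, hy2]; rfl
  rw [hT]
  obtain ⟨h, hB⟩ := hBT w
  have h1 := ContinuousLinearMap.adjoint_inner_right B ⟨T w, h⟩ f
  rw [hx', hB] at h1
  refine h1.trans ?_
  change _ = inner ℂ (w : H) (f - inner ℂ e f • e)
  rw [inner_sub_left, inner_sub_right, inner_smul_left, inner_smul_right, inner_conj_symm]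
  ring

/-! ### Spectral gap, closed range and the covariance formula in a Hilbert complex -/

section Gap

variable {T : H →ₗ.[ℂ] K} {e : H} {G : H →L[ℂ] H}

lemma energyOperator_spec (hTd : Dense (T.domain : Set H))
    (u : (formOperator T.domain (energyForm T)).domain) :
    ∃ h : (u : H) ∈ T.domain, ∀ w : T.domain, inner ℂ (T w) (T ⟨u, h⟩) =
      inner ℂ (w : H) (formOperator T.domain (energyForm T) u) :=
  formOperator_spec hTd _ u

lemma energyOperator_of_inner_eq (hTd : Dense (T.domain : Set H)) {u f : H} (hu : u ∈ T.domain)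
    (h : ∀ w : T.domain, inner ℂ (T w) (T ⟨u, hu⟩) = inner ℂ (w : H) f) :
    ∃ h : u ∈ (formOperator T.domain (energyForm T)).domain,
      formOperator T.domain (energyForm T) ⟨u, h⟩ = f :=
  formOperator_of_mem_formGraph hTd _ ⟨hu, h⟩

/-- Test the form identity against `e`, which `T` annihilates. -/
lemma inner_energyOperator_eq_zero (hTd : Dense (T.domain : Set H)) (he : (e, (0 : K)) ∈ T.graph)
    (u : (formOperator T.domain (energyForm T)).domain) :
    inner ℂ e (formOperator T.domain (energyForm T) u) = 0 := by
  obtain ⟨y, rfl, hy⟩ := (LinearPMap.mem_graph_iff _).1 he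
  obtain ⟨h, hw⟩ := energyOperator_spec hTd u
  rw [← hw y, hy, inner_zero_left]

lemma energyOperator_apply_eq_zero (hTd : Dense (T.domain : Set H))
    (he : (e, (0 : K)) ∈ T.graph) :
    ∃ h : e ∈ (formOperator T.domain (energyForm T)).domain,
      formOperator T.domain (energyForm T) ⟨e, h⟩ = 0 := by
  obtain ⟨y, rfl, hy⟩ := (LinearPMap.mem_graph_iff _).1 he
  refine energyOperator_of_inner_eq hTd y.2 fun w => ?_
  rw [Subtype.coe_eta, hy, inner_zero_right, inner_zero_right]

/-- Testing against `u` itself gives `T u = 0`, and the Poincaré inequality does the rest. -/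
lemma eq_smul_of_energyOperator_eq_zero (hTd : Dense (T.domain : Set H)) {C : ℝ}
    (hP : ∀ u : T.domain, ‖(u : H) - inner ℂ e (u : H) • e‖ ≤ C * ‖T u‖)
    (u : (formOperator T.domain (energyForm T)).domain)
    (hu : formOperator T.domain (energyForm T) u = 0) : (u : H) = inner ℂ e (u : H) • e := by
  obtain ⟨h, hw⟩ := energyOperator_spec hTd u
  have h1 := hw ⟨u, h⟩
  rw [hu, inner_zero_right, inner_self_eq_zero] at h1
  have h2 := hP ⟨u, h⟩
  rw [h1, norm_zero, mul_zero] at h2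
  exact sub_eq_zero.1 (norm_le_zero_iff.1 h2)

/-- `u` and `G (A u)` have the same image under `A`, so they differ by a multiple of `e`; the
coefficient is read off from `G (A u) ⊥ e`. -/
lemma green_energyOperator (hTd : Dense (T.domain : Set H))
    (he : (e, (0 : K)) ∈ T.graph) {C : ℝ}
    (hP : ∀ u : T.domain, ‖(u : H) - inner ℂ e (u : H) • e‖ ≤ C * ‖T u‖)
    (hG : ∀ f, inner ℂ e (G f) = 0 ∧ ∃ h : G f ∈ T.domain,
      ∀ w : T.domain, inner ℂ (T w) (T ⟨G f, h⟩) = inner ℂ (w : H) (f - inner ℂ e f • e))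
    (u : (formOperator T.domain (energyForm T)).domain) :
    G (formOperator T.domain (energyForm T) u) = (u : H) - inner ℂ e (u : H) • e := by
  let A := formOperator T.domain (energyForm T)
  obtain ⟨h0, hGD, hGw⟩ := hG (A u)
  obtain ⟨h1, h2⟩ := energyOperator_of_inner_eq hTd hGD hGw
  rw [inner_energyOperator_eq_zero hTd he, zero_smul, sub_zero] at h2
  have h3 := eq_smul_of_energyOperator_eq_zero hTd hP (u - ⟨G (A u), h1⟩)
    (by rw [LinearPMap.map_sub, h2, sub_self])
  rw [AddSubgroupClass.coe_sub, inner_sub_right, h0, sub_zero] at h3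
  exact eq_sub_of_add_eq (by rw [← h3]; exact add_sub_cancel _ _)

/-- The operator defined by `(S v | S w) + (T* v | T* w)` is injective on the closure of the range
of `T`. -/
theorem ker_domRestrict_pairOperator [CompleteSpace H] {S : K →ₗ.[ℂ] L} (hTd : Dense (T.domain : Set H))
    (hV : Dense ((S.domain ⊓ T†.domain : Submodule ℂ K) : Set K)) :
    LinearMap.ker ((formOperator (S.domain ⊓ T†.domain) (energyFormPair S T†)).domRestrict
      (LinearMap.range T.toFun).topologicalClosure).toFun = ⊥ := by
  rw [LinearMap.ker_eq_bot']
  rintro ⟨v, hvX, hvA⟩ hv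
  obtain ⟨h, hw⟩ := formOperator_spec hV _ ⟨v, hvA⟩
  replace hv : formOperator (S.domain ⊓ T†.domain) (energyFormPair S T†) ⟨v, hvA⟩ = 0 :=
    (LinearPMap.domRestrict_apply (y := ⟨v, hvA⟩) rfl).symm.trans hv
  have h1 := hw ⟨v, h⟩
  rw [hv, inner_zero_right] at h1
  have h2 : inner ℂ (S ⟨v, h.1⟩) (S ⟨v, h.1⟩) + inner ℂ (T† ⟨v, h.2⟩) (T† ⟨v, h.2⟩) = 0 := h1
  have h3 : T† ⟨v, h.2⟩ = 0 := by
    have h4 := congrArg RCLike.re h2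
    rw [map_add, inner_self_eq_norm_sq, inner_self_eq_norm_sq, map_zero] at h4
    rw [← norm_eq_zero]
    nlinarith [sq_nonneg ‖S ⟨v, h.1⟩‖, sq_nonneg ‖T† ⟨v, h.2⟩‖]
  -- As `T* v = 0`, the vector `v` is orthogonal to the range of `T`, hence to its closure, which
  -- contains `v`.
  have h4 : ∀ x ∈ (LinearMap.range T.toFun).topologicalClosure, inner ℂ v x = 0 := by
    intro x hx
    have hc : IsClosed {x | inner ℂ v x = 0} := isClosed_eq (by fun_prop) continuous_const
    refine closure_minimal ?_ hc hx
    rintro _ ⟨u, rfl⟩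
    have := LinearPMap.adjoint_isFormalAdjoint hTd ⟨v, h.2⟩ u
    rw [h3, inner_zero_left] at this
    exact this.symm
  exact Subtype.ext (inner_self_eq_zero.1 (h4 v hvX))

variable [CompleteSpace H] [CompleteSpace K]

/-- If a closed, densely defined operator `T` satisfies a Poincaré inequality modulo the unit vector
`e`, then `0` is at most an isolated simple eigenvalue of `T* T`. -/
theorem zero_notMem_essentialSpectrum_energyOperator (hTd : Dense (T.domain : Set H))
    (hTc : IsClosed (T.graph : Set (H × K))) (he1 : ‖e‖ = 1) (he : (e, (0 : K)) ∈ T.graph) (C : ℝ)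
    (hP : ∀ u : T.domain, ‖(u : H) - inner ℂ e (u : H) • e‖ ≤ C * ‖T u‖) :
    (0 : ℂ) ∉ essentialSpectrum (formOperator T.domain (energyForm T)) := by
  obtain ⟨G, hG⟩ := exists_green T hTc e he1 he C hP
  obtain ⟨heA, hAe⟩ := energyOperator_apply_eq_zero hTd he
  have hGA := green_energyOperator hTd he hP hG
  have hker := eq_smul_of_energyOperator_eq_zero hTd hP
  have horth := inner_energyOperator_eq_zero hTd he
  have hAG : ∀ f, ∃ h, formOperator T.domain (energyForm T) ⟨G f, h⟩ = f - inner ℂ e f • e :=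
    fun f => by
      obtain ⟨-, h1, h2⟩ := hG f
      exact energyOperator_of_inner_eq hTd h1 h2
  set A := formOperator T.domain (energyForm T) with hA
  rintro ⟨h0, hd⟩
  -- Inside this radius `‖z G‖ < 1`, so `1 - z G` is invertible; the `+ 1` covers `G = 0`.
  refine hd ⟨h0, ⟨(‖G‖ + 1)⁻¹, by positivity, fun z hz hz0 => ?_⟩, ?_, ?_⟩
  · by_contra! hlt
    rw [sub_zero] at hlt
    refine hz ?_
    have hzG : ‖z • G‖ < 1 := by
      rw [norm_smul]
      have h1 : ‖z‖ * (‖G‖ + 1) < 1 := by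
        rwa [← lt_div_iff₀ (by positivity), one_div]
      have := norm_nonneg z
      nlinarith
    obtain ⟨N, hN⟩ : ∃ N : (H →L[ℂ] H)ˣ, (N : H →L[ℂ] H) = 1 - z • G :=
      ⟨Units.oneSub _ hzG, rfl⟩
    set M : H →L[ℂ] H := ((N⁻¹ : (H →L[ℂ] H)ˣ) : H →L[ℂ] H) with hM
    have hNM : ∀ y, M y - z • G (M y) = y := fun y => by
      have := congrArg (fun f : H →L[ℂ] H => f y) N.mul_inv
      rw [hN] at this
      exact this
    have hPM : ∀ y, inner ℂ e (M y) = inner ℂ e y := fun y => by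
      have := congrArg (fun x => inner ℂ e x) (hNM y)
      simpa [inner_sub_right, inner_smul_right, (hG _).1] using this
    -- The resolvent is `G (1 - z G)⁻¹` on the orthogonal complement of `e`, and `-z⁻¹` on the line
    -- of `e`, where `A` vanishes.
    let P : H →L[ℂ] H := (innerSL ℂ e).smulRight e
    let R : H →L[ℂ] H := G.comp M - z⁻¹ • P
    have hR : ∀ y, ∃ h : R y ∈ A.domain, A ⟨R y, h⟩ - z • R y = y := fun y => by
      obtain ⟨h1, h2⟩ := hAG (M y)
      have hRy : R y = ((⟨G (M y), h1⟩ - (z⁻¹ * inner ℂ e y) • ⟨e, heA⟩ : A.domain) : H) := by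
        simp [R, P, mul_smul]
      refine ⟨hRy ▸ Subtype.prop _, ?_⟩
      have hARy : A ⟨R y, hRy ▸ Subtype.prop _⟩ = M y - inner ℂ e y • e := by
        rw [show (⟨R y, hRy ▸ Subtype.prop _⟩ : A.domain) =
          ⟨G (M y), h1⟩ - (z⁻¹ * inner ℂ e y) • ⟨e, heA⟩ from Subtype.ext hRy,
          LinearPMap.map_sub, LinearPMap.map_smul, hAe, h2, smul_zero, sub_zero, hPM]
      rw [hARy, hRy]
      simp only [AddSubgroupClass.coe_sub, SetLike.val_smul, smul_sub, smul_smul]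
      rw [mul_inv_cancel_left₀ hz0]
      calc M y - inner ℂ e y • e - (z • G (M y) - inner ℂ e y • e) = M y - z • G (M y) := by abel
        _ = y := hNM y
    refine ⟨R, hR, fun x => ?_⟩
    obtain ⟨h1, h2⟩ := hR (A x - z • (x : H))
    set y := A x - z • (x : H)
    -- The defect `d = R y - x` satisfies `A d = z d`. So `d ⊥ e`, because the range of `A` is
    -- orthogonal to `e` and `z ≠ 0`; applying `G` gives `d = z G d`, and invertibility of `1 - z G`
    -- gives `d = 0`.
    have h3 : A (⟨R y, h1⟩ - x) = z • (R y - x) := by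
      rw [LinearPMap.map_sub, ← sub_eq_zero]
      have h4 : A ⟨R y, h1⟩ - z • R y = A x - z • (x : H) := h2
      rw [smul_sub, sub_sub_sub_comm, h4, sub_self]
    have h5 : inner ℂ e (R y - x) = 0 := by
      have := horth (⟨R y, h1⟩ - x)
      rw [h3, inner_smul_right] at this
      exact (mul_eq_zero.1 this).resolve_left hz0
    have h6 := hGA (⟨R y, h1⟩ - x)
    rw [h3, AddSubgroupClass.coe_sub] at h6
    simp only [h5, zero_smul, sub_zero] at h6
    have h7 : (N : H →L[ℂ] H) (R y - x) = 0 := by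
      rw [hN]
      change (R y - x) - z • G (R y - x) = 0
      rw [← map_smul, h6, sub_self]
    have h8 : R y - x = M ((N : H →L[ℂ] H) (R y - x)) :=
      (congrArg (fun f : H →L[ℂ] H => f (R y - x)) N.inv_mul).symm
    rw [h7, map_zero] at h8
    exact sub_eq_zero.1 h8
  · intro hbot
    have h1 : (⟨e, heA⟩ : A.domain) ∈ eigenspace A 0 := by
      rw [eigenspace, LinearMap.mem_ker, zero_smul, sub_zero]
      exact hAe
    rw [hbot, Submodule.mem_bot] at h1
    have : e = 0 := congrArg Subtype.val h1
    rw [this, norm_zero] at he1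
    exact zero_ne_one he1
  · have hle : eigenspace A 0 ≤ Submodule.span ℂ {(⟨e, heA⟩ : A.domain)} := fun u hu => by
      rw [eigenspace, LinearMap.mem_ker, zero_smul, sub_zero] at hu
      exact Submodule.mem_span_singleton.2 ⟨inner ℂ e (u : H), Subtype.ext (hker u hu).symm⟩
    exact Submodule.finiteDimensional_of_le hle

/-- If a closed, densely defined operator `T` satisfies a Poincaré inequality modulo the unit vector
`e`, then `T* T` has closed range. -/
theorem isClosed_range_energyOperator (hTd : Dense (T.domain : Set H))
    (hTc : IsClosed (T.graph : Set (H × K))) (he1 : ‖e‖ = 1) (he : (e, (0 : K)) ∈ T.graph) (C : ℝ)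
    (hP : ∀ u : T.domain, ‖(u : H) - inner ℂ e (u : H) • e‖ ≤ C * ‖T u‖) :
    IsClosed (LinearMap.range (formOperator T.domain (energyForm T)).toFun : Set H) := by
  obtain ⟨G, hG⟩ := exists_green T hTc e he1 he C hP
  have : (LinearMap.range (formOperator T.domain (energyForm T)).toFun : Set H) =
      {f | inner ℂ e f = 0} := by
    ext f
    constructor
    · rintro ⟨u, rfl⟩
      exact inner_energyOperator_eq_zero hTd he u
    · intro hf
      obtain ⟨-, h1, h2⟩ := hG f
      obtain ⟨h3, h4⟩ := energyOperator_of_inner_eq hTd h1 h2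
      refine ⟨⟨G f, h3⟩, h4.trans ?_⟩
      rw [show inner ℂ e f = 0 from hf, zero_smul, sub_zero]
  rw [this]
  exact isClosed_eq (by fun_prop) continuous_const

variable {S : K →ₗ.[ℂ] L}

/-- The Helffer–Sjöstrand formula in an abstract Hilbert complex. -/
theorem inner_inverse_pairOperator (hTd : Dense (T.domain : Set H))
    (hTc : IsClosed (T.graph : Set (H × K))) (he1 : ‖e‖ = 1) (he : (e, (0 : K)) ∈ T.graph) (C : ℝ)
    (hP : ∀ u : T.domain, ‖(u : H) - inner ℂ e (u : H) • e‖ ≤ C * ‖T u‖)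
    (hV : Dense ((S.domain ⊓ T†.domain : Submodule ℂ K) : Set K))
    (hST : ∀ u : T.domain, ∃ h : T u ∈ S.domain, S ⟨T u, h⟩ = 0) (g₁ g₂ : T.domain) :
    ∃ h : T g₁ ∈ ((formOperator (S.domain ⊓ T†.domain) (energyFormPair S T†)).domRestrict
        (LinearMap.range T.toFun).topologicalClosure).inverse.domain,
      inner ℂ (g₂ : H) ((g₁ : H) - inner ℂ e (g₁ : H) • e) =
        inner ℂ (T g₂) (((formOperator (S.domain ⊓ T†.domain) (energyFormPair S T†)).domRestrict
          (LinearMap.range T.toFun).topologicalClosure).inverse ⟨T g₁, h⟩) := by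
  obtain ⟨G, hG⟩ := exists_green T hTc e he1 he C hP
  obtain ⟨-, hGD, hGw⟩ := hG g₁
  -- The candidate for `A₁⁻¹ T g₁`. The defining property of `G` says exactly that `T* v = g₁ - (g₁
  -- | e) e`.
  set v := T ⟨G g₁, hGD⟩ with hv
  obtain ⟨hvS, hSv⟩ := hST ⟨G g₁, hGD⟩
  rw [← hv] at hvS
  have hadj : ∀ x : T.domain,
      inner ℂ ((g₁ : H) - inner ℂ e (g₁ : H) • e) (x : H) = inner ℂ v (T x) := fun x => by
    rw [← inner_conj_symm, ← hGw x, inner_conj_symm]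
  have hvT : v ∈ T†.domain := LinearPMap.mem_adjoint_domain_of_exists v ⟨_, hadj⟩
  have hTv : T† ⟨v, hvT⟩ = (g₁ : H) - inner ℂ e (g₁ : H) • e :=
    LinearPMap.adjoint_apply_eq hTd ⟨v, hvT⟩ hadj
  obtain ⟨y, hy1, hy2⟩ := (LinearPMap.mem_graph_iff _).1 he
  have hmem : (v, T g₁) ∈ formGraph (S.domain ⊓ T†.domain) (energyFormPair S T†) := by
    refine ⟨⟨hvS, hvT⟩, fun w => ?_⟩
    change inner ℂ (S ⟨w, w.2.1⟩) (S ⟨v, hvS⟩) + inner ℂ (T† ⟨w, w.2.2⟩) (T† ⟨v, hvT⟩) =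
      inner ℂ (w : K) (T g₁)
    have h1 : ∀ x : T.domain, inner ℂ (T† ⟨w, w.2.2⟩) (x : H) = inner ℂ (w : K) (T x) :=
      LinearPMap.adjoint_isFormalAdjoint hTd ⟨w, w.2.2⟩
    -- The range of `T*` is orthogonal to `e` because `T e = 0`, so the subtracted mean does not
    -- contribute.
    have h2 : inner ℂ (T† ⟨w, w.2.2⟩) e = 0 := by
      rw [← show (y : H) = e from hy1, h1 y, hy2, inner_zero_right]
    rw [show S ⟨v, hvS⟩ = 0 from hSv, inner_zero_right, zero_add, hTv, inner_sub_right,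
      inner_smul_right, h1 g₁, h2, mul_zero, sub_zero]
  obtain ⟨hvA, hAv⟩ := formOperator_of_mem_formGraph hV _ hmem
  have hvX : v ∈ (LinearMap.range T.toFun).topologicalClosure :=
    Submodule.le_topologicalClosure _ ⟨⟨G g₁, hGD⟩, rfl⟩
  set B := (formOperator (S.domain ⊓ T†.domain) (energyFormPair S T†)).domRestrict
    (LinearMap.range T.toFun).topologicalClosure with hB
  have hBv : B ⟨v, hvX, hvA⟩ = T g₁ := (LinearPMap.domRestrict_apply rfl).trans hAv
  have hd : T g₁ ∈ B.inverse.domain := by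
    rw [LinearPMap.inverse_domain]
    exact ⟨_, hBv⟩
  refine ⟨hd, ?_⟩
  rw [LinearPMap.inverse_apply_eq (ker_domRestrict_pairOperator hTd hV) (x := ⟨v, hvX, hvA⟩) hBv]
  exact (hGw g₂).symm

end Gap

end Abstract

/-! ### Mollification in `L²` and weak gradients -/

section Mollify

open Filter Topology ContinuousLinearMap
open scoped Convolution

variable {n : ℕ} {F : Type*} [NormedAddCommGroup F]

/-- Translations are continuous in `L²`. -/
lemma tendsto_eLpNorm_translate_sub {f : E n → F} (hf : MemLp f 2 volume) :
    Tendsto (fun y : E n => eLpNorm (fun x => f (x - y) - f x) 2 volume) (𝓝 0) (𝓝 0) := by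
  let g : C(E n, C(E n, E n)) := ContinuousMap.curry ⟨fun p => p.2 - p.1, by fun_prop⟩
  have hgm : ∀ y, MeasurePreserving (g y) (volume : Measure (E n)) volume :=
    fun y => measurePreserving_sub_right volume y
  have hc : Continuous fun y => Lp.compMeasurePreserving (g y) (hgm y) (hf.toLp f) :=
    continuous_const.compMeasurePreservingLp g.continuous hgm (by norm_num)
  have h0 : Lp.compMeasurePreserving (g 0) (hgm 0) (hf.toLp f) = hf.toLp f := by
    refine Lp.ext ((Lp.coeFn_compMeasurePreserving _ _).trans ?_)
    refine Filter.Eventually.of_forall fun x => ?_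
    simp [g]
  have h1 := tendsto_iff_edist_tendsto_0.1 (hc.tendsto 0)
  rw [h0] at h1
  refine h1.congr fun y => ?_
  rw [Lp.edist_def]
  refine eLpNorm_congr_ae ?_
  have h2 := (hgm y).quasiMeasurePreserving.ae_eq_comp hf.coeFn_toLp
  filter_upwards [hf.coeFn_toLp, Lp.coeFn_compMeasurePreserving (hf.toLp f) (hgm y), h2]
    with x hx1 hx2 hx3
  rw [Pi.sub_apply, hx1, hx2, hx3]
  rfl

lemma eLpNorm_two_sq_eq_lintegral {α : Type*} [MeasurableSpace α] {μ : Measure α} {f : α → F} :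
    eLpNorm f 2 μ ^ 2 = ∫⁻ x, ‖f x‖ₑ ^ 2 ∂μ := by
  have := eLpNorm_nnreal_pow_eq_lintegral (f := f) (μ := μ) (p := 2) (by norm_num)
  simpa using this

/-- Jensen's inequality for the square, obtained from the monotonicity of the `Lᵖ` norms on a
probability space. -/
lemma sq_lintegral_enorm_le {α : Type*} [MeasurableSpace α] {μ : Measure α} [IsProbabilityMeasure μ]
    {f : α → F} (hf : AEStronglyMeasurable f μ) :
    (∫⁻ x, ‖f x‖ₑ ∂μ) ^ 2 ≤ ∫⁻ x, ‖f x‖ₑ ^ 2 ∂μ := by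
  rw [← eLpNorm_two_sq_eq_lintegral, ← eLpNorm_one_eq_lintegral_enorm]
  gcongr
  exact eLpNorm_le_eLpNorm_of_exponent_le (by norm_num) hf

variable [NormedSpace ℝ F]

/-- The mollification of `f` by a normalized bump function. -/
def mollify (φ : ContDiffBump (0 : E n)) (f : E n → F) : E n → F :=
  φ.normed volume ⋆[lsmul ℝ ℝ, volume] f

/-- `mollify φ f - f` is the average of the differences `f (x - y) - f x` over the probability
measure `ν` whose density is the bump. Jensen and Tonelli reduce its `L²` norm to an average of
translation errors, and `ν` only sees `y` in the support of the bump. -/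
lemma eLpNorm_mollify_sub_le [CompleteSpace F] (φ : ContDiffBump (0 : E n)) {f : E n → F}
    (hf : MemLp f 2 volume) {ε : ENNReal}
    (hε : ∀ y ∈ Metric.ball (0 : E n) φ.rOut,
      eLpNorm (fun x => f (x - y) - f x) 2 volume ≤ ε) :
    eLpNorm (mollify φ f - f) 2 volume ≤ ε := by
  set ψ := φ.normed (volume : Measure (E n)) with hψ
  have hψc : Continuous ψ := φ.continuous_normed
  have hψi : Integrable ψ volume := φ.integrable_normed
  set ν := (volume : Measure (E n)).withDensity fun y => ENNReal.ofReal (ψ y) with hν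
  have hν1 : IsProbabilityMeasure ν := by
    refine ⟨?_⟩
    rw [hν, withDensity_apply _ MeasurableSet.univ, Measure.restrict_univ,
      ← ofReal_integral_eq_lintegral_ofReal hψi (ae_of_all _ φ.nonneg_normed), φ.integral_normed,
      ENNReal.ofReal_one]
  have hνv : ν ≪ volume := withDensity_absolutelyContinuous _ _
  have hνball : ∀ᵐ y ∂ν, y ∈ Metric.ball (0 : E n) φ.rOut := by
    rw [hν, ae_withDensity_iff (by fun_prop)]
    refine ae_of_all _ fun y hy => ?_
    rw [← φ.support_normed_eq (μ := volume)]
    intro h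
    exact hy (by rw [hψ, h, ENNReal.ofReal_zero])
  have hνint : ∀ g : E n → F, ∫ y, g y ∂ν = ∫ y, ψ y • g y := fun g => by
    rw [hν, integral_withDensity_eq_integral_toReal_smul (by fun_prop) (by simp)]
    refine integral_congr_ae (ae_of_all _ fun y => ?_)
    change (ENNReal.ofReal (ψ y)).toReal • g y = _
    rw [ENNReal.toReal_ofReal (φ.nonneg_normed y)]
  have hfl : LocallyIntegrable f volume := hf.locallyIntegrable (by norm_num)
  have hconv : ∀ x, Integrable (fun y => ψ y • f (x - y)) volume := fun x =>
    φ.hasCompactSupport_normed.convolutionExists_left (lsmul ℝ ℝ) hψc hfl x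
  have hdiff : ∀ x, mollify φ f x - f x = ∫ y, (f (x - y) - f x) ∂ν := fun x => by
    rw [hνint]
    simp only [smul_sub]
    rw [integral_sub (hconv x) (hψi.smul_const _), integral_smul_const, φ.integral_normed, one_smul]
    rfl
  have hms : AEStronglyMeasurable (fun p : E n × E n => f (p.1 - p.2) - f p.1)
      (volume.prod ν) := by
    refine AEStronglyMeasurable.mono_ac (Measure.AbsolutelyContinuous.rfl.prod hνv) ?_
    exact (hf.1.comp_quasiMeasurePreserving (quasiMeasurePreserving_sub volume volume)).sub
      (hf.1.comp_quasiMeasurePreserving Measure.quasiMeasurePreserving_fst)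
  have hpt : ∀ᵐ x, ‖(mollify φ f - f) x‖ₑ ^ 2 ≤ ∫⁻ y, ‖f (x - y) - f x‖ₑ ^ 2 ∂ν := by
    filter_upwards [hms.prodMk_left] with x hx
    rw [Pi.sub_apply, hdiff]
    refine le_trans ?_ (sq_lintegral_enorm_le hx)
    gcongr
    exact enorm_integral_le_lintegral_enorm _
  rw [← ENNReal.pow_le_pow_left_iff (n := 2) (by norm_num), eLpNorm_two_sq_eq_lintegral]
  calc ∫⁻ x, ‖(mollify φ f - f) x‖ₑ ^ 2
      ≤ ∫⁻ x, ∫⁻ y, ‖f (x - y) - f x‖ₑ ^ 2 ∂ν := lintegral_mono_ae hpt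
    _ = ∫⁻ y, ∫⁻ x, ‖f (x - y) - f x‖ₑ ^ 2 ∂volume ∂ν := 
      lintegral_lintegral_swap (hms.enorm.pow_const 2)
    _ ≤ ∫⁻ y, ε ^ 2 ∂ν := by
      refine lintegral_mono_ae ?_
      filter_upwards [hνball] with y hy
      rw [← eLpNorm_two_sq_eq_lintegral]
      gcongr
      exact hε y hy
    _ = ε ^ 2 := by simp

lemma exists_eLpNorm_mollify_sub_le [CompleteSpace F] {f : E n → F} (hf : MemLp f 2 volume)
    {ε : ENNReal} (hε : ε ≠ 0) :
    ∃ δ > 0, ∀ φ : ContDiffBump (0 : E n), φ.rOut ≤ δ →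
      eLpNorm (mollify φ f - f) 2 volume ≤ ε := by
  have h1 := (tendsto_eLpNorm_translate_sub hf).eventually (Iic_mem_nhds hε.bot_lt)
  obtain ⟨δ, hδ, h2⟩ := Metric.eventually_nhds_iff_ball.1 h1
  exact ⟨δ, hδ, fun φ hφ => eLpNorm_mollify_sub_le φ hf fun y hy =>
    h2 y (Metric.ball_subset_ball hφ hy)⟩

lemma contDiff_mollify (φ : ContDiffBump (0 : E n)) {f : E n → F}
    (hf : LocallyIntegrable f volume) : ContDiff ℝ ∞ (mollify φ f) :=
  φ.hasCompactSupport_normed.contDiff_convolution_left _ φ.contDiff_normed hf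

lemma support_mollify_subset (φ : ContDiffBump (0 : E n)) {f : E n → F} {r : ℝ}
    (hr : Function.support f ⊆ Metric.closedBall 0 r) :
    Function.support (mollify φ f) ⊆ Metric.closedBall 0 (φ.rOut + r) := by
  refine (support_convolution_subset _).trans ?_
  rintro _ ⟨x, hx, y, hy, rfl⟩
  rw [φ.support_normed_eq, mem_ball_zero_iff] at hx
  have := hr hy
  rw [mem_closedBall_zero_iff] at this ⊢
  exact (norm_add_le _ _).trans (by linarith)

/-- `v` is the gradient of `u` in the sense of distributions. -/
def IsWeakGrad (u : E n → ℂ) (v : E n → EuclideanSpace ℂ (Fin n)) : Prop :=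
  ∀ (j : Fin n) (φ : E n → ℝ), ContDiff ℝ ∞ φ → HasCompactSupport φ →
    pairing u (partialDeriv j φ) = -pairing (fun x => v x j) φ

/-- The gradient of a complex function. -/
def cgrad (f : E n → ℂ) (x : E n) : EuclideanSpace ℂ (Fin n) :=
  WithLp.toLp 2 fun j => fderiv ℝ f x (EuclideanSpace.single j 1)

/-- The derivative of the convolution falls on the bump `ψ`. Applying the weak derivative to the
test function `t ↦ ψ (x - t)` moves it to `u`; the sign from reflecting the argument cancels the one
in the definition of the weak derivative. -/
lemma cgrad_mollify (φ : ContDiffBump (0 : E n)) {u : E n → ℂ}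
    {v : E n → EuclideanSpace ℂ (Fin n)} (hu : LocallyIntegrable u volume)
    (hv : LocallyIntegrable v volume) (h : IsWeakGrad u v) :
    cgrad (mollify φ u) = mollify φ v := by
  set ψ := φ.normed (volume : Measure (E n)) with hψ
  have hψs : ContDiff ℝ ∞ ψ := φ.contDiff_normed
  have hψk : HasCompactSupport ψ := φ.hasCompactSupport_normed
  ext x j
  have hD := (hψk.hasFDerivAt_convolution_left (lsmul ℝ ℝ) (hψs.of_le (by simp)) hu x).fderiv
  have h1 : cgrad (mollify φ u) x j =
      ∫ t, partialDeriv j ψ (x - t) • u t := by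
    change fderiv ℝ (mollify φ u) x (EuclideanSpace.single j 1) = _
    rw [show fderiv ℝ (mollify φ u) x = _ from hD, ← convolution_flip,
      show ((lsmul ℝ ℝ : ℝ →L[ℝ] ℂ →L[ℝ] ℂ).precompL (E n)).flip =
        ((lsmul ℝ ℝ : ℝ →L[ℝ] ℂ →L[ℝ] ℂ).flip).precompR (E n) from rfl,
      convolution_precompR_apply _ hu (hψk.fderiv ℝ) (hψs.continuous_fderiv (by simp))]
    rfl
  have hshift : ContDiff ℝ ∞ fun t => ψ (x - t) := hψs.comp (by fun_prop)
  have hshiftk : HasCompactSupport fun t => ψ (x - t) :=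
    hψk.comp_homeomorph (Homeomorph.subLeft x)
  have h2 : ∀ t, partialDeriv j (fun t => ψ (x - t)) t = -partialDeriv j ψ (x - t) := fun t => by
    unfold partialDeriv
    have h3 : HasFDerivAt (fun t => x - t) (-ContinuousLinearMap.id ℝ (E n)) t :=
      (hasFDerivAt_id t).const_sub x
    have h4 := ((hψs.differentiable (by simp)) (x - t)).hasFDerivAt.comp t h3
    rw [show fderiv ℝ (fun t => ψ (x - t)) t = _ from h4.fderiv]
    simp
  have h5 := h j _ hshift hshiftk
  unfold pairing at h5
  simp only [h2, neg_smul] at h5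
  rw [integral_neg, neg_inj] at h5
  rw [h1, h5]
  have h6 : Integrable (fun t => ψ (x - t) • v t) volume :=
    hv.integrable_smul_left_of_hasCompactSupport hshift.continuous hshiftk
  have h7 := ((EuclideanSpace.proj j : EuclideanSpace ℂ (Fin n) →L[ℂ] ℂ).restrictScalars
    ℝ).integral_comp_comm h6
  rw [mollify, convolution_eq_swap]
  refine Eq.trans ?_ h7
  rfl

end Mollify

/-! ### Density of test functions in `H¹(μ)`: cutoff and mollification -/

section Density

open Filter Topology

variable {n : ℕ}

/-- The weight is bounded on compact sets. With `exists_volume_restrict_le`, this makes `μ` and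
Lebesgue measure comparable there, so that unweighted estimates can be transferred. -/
lemma exists_gibbs_restrict_le {Φ : E n → ℝ} (hΦ : Continuous Φ) {B : Set (E n)}
    (hB : IsCompact B) : ∃ M : ENNReal, M ≠ ⊤ ∧ (gibbs Φ).restrict B ≤ M • volume := by
  obtain ⟨C, hC⟩ := hB.exists_bound_of_continuousOn
    (f := fun x => Real.exp (-Φ x)) (by fun_prop)
  refine ⟨ENNReal.ofReal C, ENNReal.ofReal_ne_top, ?_⟩
  rw [gibbs, restrict_withDensity hB.measurableSet]
  calc _ ≤ (volume.restrict B).withDensity fun _ => ENNReal.ofReal C := by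
        refine withDensity_mono ?_
        filter_upwards [ae_restrict_mem hB.measurableSet] with x hx
        exact ENNReal.ofReal_le_ofReal ((le_abs_self _).trans (hC x hx))
    _ = ENNReal.ofReal C • volume.restrict B := withDensity_const _
    _ ≤ _ := by gcongr; exact Measure.restrict_le_self

lemma exists_volume_restrict_le {Φ : E n → ℝ} (hΦ : Continuous Φ) {B : Set (E n)}
    (hB : IsCompact B) : ∃ M : ENNReal, M ≠ ⊤ ∧ volume.restrict B ≤ M • gibbs Φ := by
  obtain ⟨C, hC⟩ := hB.exists_bound_of_continuousOn (f := fun x => Real.exp (Φ x)) (by fun_prop)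
  refine ⟨ENNReal.ofReal C, ENNReal.ofReal_ne_top, ?_⟩
  have h1 : volume.restrict B =
      ((gibbs Φ).restrict B).withDensity fun x => ENNReal.ofReal (Real.exp (Φ x)) := by
    rw [gibbs, restrict_withDensity hB.measurableSet, ← withDensity_mul _ (by fun_prop)
      (by fun_prop)]
    have : (fun x => ENNReal.ofReal (Real.exp (-Φ x))) * (fun x => ENNReal.ofReal (Real.exp (Φ x)))
        = 1 := by
      ext x
      rw [Pi.mul_apply, ← ENNReal.ofReal_mul (Real.exp_pos _).le, ← Real.exp_add]
      simp
    rw [this, withDensity_one]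
  rw [h1]
  calc _ ≤ ((gibbs Φ).restrict B).withDensity fun _ => ENNReal.ofReal C := by
        refine withDensity_mono ?_
        filter_upwards [ae_restrict_mem hB.measurableSet] with x hx
        exact ENNReal.ofReal_le_ofReal ((le_abs_self _).trans (hC x hx))
    _ = ENNReal.ofReal C • (gibbs Φ).restrict B := withDensity_const _
    _ ≤ _ := by gcongr; exact Measure.restrict_le_self

/-- The gradient of a real function, as a vector field with complex coefficients. -/
def rgrad (χ : E n → ℝ) (x : E n) : EuclideanSpace ℂ (Fin n) :=
  WithLp.toLp 2 fun j => (partialDeriv j χ x : ℂ)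

lemma continuous_rgrad {χ : E n → ℝ} (hχ : ContDiff ℝ ∞ χ) : Continuous (rgrad χ) := by
  refine (PiLp.continuous_toLp 2 _).comp (continuous_pi fun j => ?_)
  exact Complex.continuous_ofReal.comp (continuous_partialDeriv hχ j)

lemma locallyIntegrable_apply {v : E n → EuclideanSpace ℂ (Fin n)}
    (hv : LocallyIntegrable v volume) (j : Fin n) :
    LocallyIntegrable (fun x => v x j) volume := by
  rw [locallyIntegrable_iff] at hv ⊢
  exact fun k hk => ((EuclideanSpace.proj j :
    EuclideanSpace ℂ (Fin n) →L[ℂ] ℂ).restrictScalars ℝ).integrable_comp (hv k hk)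

lemma partialDeriv_mul {χ φ : E n → ℝ} (hχ : ContDiff ℝ ∞ χ) (hφ : ContDiff ℝ ∞ φ) (j : Fin n)
    (x : E n) : partialDeriv j (fun x => χ x * φ x) x =
      χ x * partialDeriv j φ x + φ x * partialDeriv j χ x := by
  unfold partialDeriv
  rw [fderiv_fun_mul (hχ.differentiable (by simp) x) (hφ.differentiable (by simp) x)]
  simp

/-- The product rule, obtained by using `χ φ` as a test function for `u`. -/
lemma IsWeakGrad.smul {u : E n → ℂ} {v : E n → EuclideanSpace ℂ (Fin n)} (h : IsWeakGrad u v)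
    (hu : LocallyIntegrable u volume) (hv : LocallyIntegrable v volume) {χ : E n → ℝ}
    (hχ : ContDiff ℝ ∞ χ) :
    IsWeakGrad (fun x => χ x • u x) (fun x => χ x • v x + u x • rgrad χ x) := by
  intro j φ hφ hs
  have h1 := h j (fun x => χ x * φ x) (hχ.mul hφ) hs.mul_left
  have hi1 : Integrable (fun x => (χ x * partialDeriv j φ x) • u x) volume :=
    hu.integrable_smul_left_of_hasCompactSupport
      (hχ.continuous.mul (continuous_partialDeriv hφ j)) (hasCompactSupport_partialDeriv hs j).mul_left
  have hi2 : Integrable (fun x => (φ x * partialDeriv j χ x) • u x) volume :=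
    hu.integrable_smul_left_of_hasCompactSupport
      (hφ.continuous.mul (continuous_partialDeriv hχ j)) hs.mul_right
  have hi3 : Integrable (fun x => (χ x * φ x) • v x j) volume :=
    (locallyIntegrable_apply hv j).integrable_smul_left_of_hasCompactSupport
      (hχ.continuous.mul hφ.continuous) hs.mul_left
  unfold pairing at h1 ⊢
  simp only [partialDeriv_mul hχ hφ, add_smul] at h1
  rw [integral_add hi1 hi2] at h1
  have h2 : ∫ x, φ x • (χ x • v x + u x • rgrad χ x) j =
      (∫ x, (χ x * φ x) • v x j) + ∫ x, (φ x * partialDeriv j χ x) • u x := by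
    rw [← integral_add hi3 hi2]
    congr 1 with x
    simp only [PiLp.add_apply, PiLp.smul_apply, rgrad, smul_eq_mul, Complex.real_smul]
    push_cast
    ring
  have h3 : ∫ x, partialDeriv j φ x • χ x • u x = ∫ x, (χ x * partialDeriv j φ x) • u x := by
    congr 1 with x
    rw [smul_smul, mul_comm]
  rw [h2, h3, neg_add, ← h1]
  ring

/-- A smooth cutoff function, equal to `1` on the unit ball. -/
def bump : ContDiffBump (0 : E n) := ⟨1, 2, one_pos, one_lt_two⟩

/-- The cutoff function `bump`, rescaled by the factor `k + 1`. -/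
def cutoff (k : ℕ) (x : E n) : ℝ := bump (((k : ℝ) + 1)⁻¹ • x)

lemma contDiff_cutoff (k : ℕ) : ContDiff ℝ ∞ (cutoff k : E n → ℝ) :=
  bump.contDiff.comp (by fun_prop)

lemma abs_cutoff_sub_one_le (k : ℕ) (x : E n) : |cutoff k x - 1| ≤ 1 := by
  have h1 : 0 ≤ cutoff k x := bump.nonneg
  have h2 : cutoff k x ≤ 1 := bump.le_one
  rw [abs_le]; constructor <;> linarith

lemma cutoff_eq_zero {k : ℕ} {x : E n} (h : 2 * ((k : ℝ) + 1) < ‖x‖) : cutoff k x = 0 := by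
  refine bump.zero_of_le_dist ?_
  rw [dist_zero_right, norm_smul, norm_inv, Real.norm_of_nonneg (by positivity)]
  rw [← div_eq_inv_mul, le_div_iff₀ (by positivity)]
  exact h.le

lemma eventually_cutoff_eq_one (x : E n) : ∀ᶠ k : ℕ in atTop, cutoff k x = 1 := by
  filter_upwards [(tendsto_natCast_atTop_atTop (R := ℝ)).eventually_ge_atTop ‖x‖] with k hk
  refine bump.one_of_mem_closedBall ?_
  rw [mem_closedBall_zero_iff, norm_smul, norm_inv, Real.norm_of_nonneg (by positivity),
    ← div_eq_inv_mul, div_le_iff₀ (by positivity)]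
  change ‖x‖ ≤ 1 * _
  linarith

lemma rgrad_cutoff (k : ℕ) (x : E n) :
    rgrad (cutoff k) x = ((k : ℝ) + 1)⁻¹ • rgrad bump (((k : ℝ) + 1)⁻¹ • x) := by
  ext j
  have h1 : HasFDerivAt (fun x : E n => ((k : ℝ) + 1)⁻¹ • x)
      (((k : ℝ) + 1)⁻¹ • ContinuousLinearMap.id ℝ (E n)) x :=
    (((k : ℝ) + 1)⁻¹ • ContinuousLinearMap.id ℝ (E n)).hasFDerivAt
  have h2 := ((bump (n := n)).contDiff (n := 1).differentiable (by simp)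
    (((k : ℝ) + 1)⁻¹ • x)).hasFDerivAt.comp x h1
  simp only [rgrad, partialDeriv, PiLp.smul_apply, Complex.real_smul]
  rw [show fderiv ℝ (cutoff k) x = _ from h2.fderiv]
  simp

/-- Scaling: the gradient of the fixed bump is bounded, and the dilation contributes the factor `1 /
(k + 1)`, which makes the commutator term `u ∇χ` disappear in the limit. -/
lemma exists_norm_rgrad_cutoff_le :
    ∃ C : ℝ, ∀ (k : ℕ) (x : E n), ‖rgrad (cutoff k) x‖ ≤ C * ((k : ℝ) + 1)⁻¹ := by
  have hs : HasCompactSupport (rgrad (bump : ContDiffBump (0 : E n))) := by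
    refine HasCompactSupport.intro (bump (n := n)).hasCompactSupport.isCompact fun x hx => ?_
    ext j
    have : partialDeriv j bump x = 0 := image_eq_zero_of_notMem_tsupport
      fun h => hx (tsupport_fderiv_apply_subset ℝ _ h)
    simp [rgrad, this]
  obtain ⟨C, hC⟩ := hs.exists_bound_of_continuous (continuous_rgrad bump.contDiff)
  refine ⟨C, fun k x => ?_⟩
  rw [rgrad_cutoff, norm_smul, norm_inv, Real.norm_of_nonneg (by positivity), mul_comm]
  gcongr
  exact hC _

lemma rgrad_cutoff_eq_zero {k : ℕ} {x : E n} (h : 2 * ((k : ℝ) + 1) < ‖x‖) :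
    rgrad (cutoff k) x = 0 := by
  ext j
  have h1 : (cutoff k : E n → ℝ) =ᶠ[𝓝 x] fun _ => 0 := by
    filter_upwards [continuous_norm.continuousAt.eventually (lt_mem_nhds h)] with y hy
    exact cutoff_eq_zero hy
  simp [rgrad, partialDeriv, h1.fderiv_eq]

lemma memLp_cutoff_smul {F : Type*} [NormedAddCommGroup F] [NormedSpace ℝ F]
    {μ : Measure (E n)} {f : E n → F} (hf : MemLp f 2 μ) (k : ℕ) :
    MemLp (fun x => cutoff k x • f x) 2 μ := by
  refine hf.mono ((contDiff_cutoff k).continuous.aestronglyMeasurable.smul hf.1)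
    (ae_of_all _ fun x => ?_)
  have h1 : 0 ≤ cutoff k x := bump.nonneg
  have h2 : cutoff k x ≤ 1 := bump.le_one
  rw [norm_smul, Real.norm_of_nonneg h1]
  exact mul_le_of_le_one_left (norm_nonneg _) h2

lemma memLp_smul_rgrad_cutoff {μ : Measure (E n)} {u : E n → ℂ} (hu : MemLp u 2 μ) (k : ℕ) :
    MemLp (fun x => u x • rgrad (cutoff k) x) 2 μ := by
  obtain ⟨C, hC⟩ := exists_norm_rgrad_cutoff_le (n := n)
  refine hu.of_le_mul (c := C * ((k : ℝ) + 1)⁻¹)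
    (hu.1.smul (continuous_rgrad (contDiff_cutoff k)).aestronglyMeasurable)
    (ae_of_all _ fun x => ?_)
  rw [norm_smul, mul_comm]
  gcongr
  exact hC k x

/-- Dominated convergence, with `|f|²` as majorant. -/
lemma tendsto_eLpNorm_cutoff_smul_sub {F : Type*} [NormedAddCommGroup F] [NormedSpace ℝ F]
    {μ : Measure (E n)} {f : E n → F} (hf : MemLp f 2 μ) :
    Tendsto (fun k : ℕ => eLpNorm (fun x => cutoff k x • f x - f x) 2 μ) atTop (𝓝 0) := by
  have h1 : ∀ k x, ‖cutoff k x • f x - f x‖ₑ ^ 2 ≤ ‖f x‖ₑ ^ 2 := fun k x => by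
    gcongr
    rw [enorm_le_iff_norm_le, show cutoff k x • f x - f x = (cutoff k x - 1) • f x by module,
      norm_smul]
    exact mul_le_of_le_one_left (norm_nonneg _) (abs_cutoff_sub_one_le k x)
  have h2 : Tendsto (fun k : ℕ => ∫⁻ x, ‖cutoff k x • f x - f x‖ₑ ^ 2 ∂μ) atTop
      (𝓝 (∫⁻ _, 0 ∂μ)) := by
    refine tendsto_lintegral_of_dominated_convergence' (fun x => ‖f x‖ₑ ^ 2) (fun k => ?_)
      (fun k => ae_of_all _ (h1 k)) ?_ (ae_of_all _ fun x => ?_)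
    · exact ((((contDiff_cutoff k).continuous.aestronglyMeasurable.smul hf.1).sub
        hf.1).enorm).pow_const 2
    · rw [← eLpNorm_two_sq_eq_lintegral]
      exact ENNReal.pow_ne_top hf.2.ne
    · refine tendsto_const_nhds.congr' ?_
      filter_upwards [eventually_cutoff_eq_one x] with k hk
      simp [hk]
  rw [lintegral_zero] at h2
  have h3 := h2.ennrpow_const (1 / 2)
  simp only [← eLpNorm_two_sq_eq_lintegral] at h3
  rw [ENNReal.zero_rpow_of_pos (by norm_num)] at h3
  refine h3.congr fun k => ?_
  rw [← ENNReal.rpow_natCast, ← ENNReal.rpow_mul]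
  norm_num

lemma tendsto_eLpNorm_smul_rgrad_cutoff {μ : Measure (E n)} {u : E n → ℂ} (hu : MemLp u 2 μ) :
    Tendsto (fun k : ℕ => eLpNorm (fun x => u x • rgrad (cutoff k) x) 2 μ) atTop (𝓝 0) := by
  obtain ⟨C, hC⟩ := exists_norm_rgrad_cutoff_le (n := n)
  have h1 : ∀ k : ℕ, eLpNorm (fun x => u x • rgrad (cutoff k) x) 2 μ ≤
      ENNReal.ofReal (C * ((k : ℝ) + 1)⁻¹) * eLpNorm u 2 μ := fun k => by
    refine eLpNorm_le_mul_eLpNorm_of_ae_le_mul (ae_of_all _ fun x => ?_) _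
    rw [norm_smul, mul_comm]
    gcongr
    exact hC k x
  refine tendsto_of_tendsto_of_tendsto_of_le_of_le tendsto_const_nhds ?_ (fun _ => zero_le) h1
  have h2 : Tendsto (fun k : ℕ => C * ((k : ℝ) + 1)⁻¹) atTop (𝓝 (C * 0)) := by
    refine Tendsto.const_mul C ?_
    simpa [one_div] using tendsto_one_div_add_atTop_nhds_zero_nat (𝕜 := ℝ)
  have h3 := ENNReal.Tendsto.mul_const (ENNReal.tendsto_ofReal h2)
    (b := eLpNorm u 2 μ) (Or.inr hu.2.ne)
  simpa using h3

lemma eLpNorm_le_of_restrict_le {F : Type*} [NormedAddCommGroup F] {μ ν : Measure (E n)}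
    {B : Set (E n)} {M : ENNReal} (h : μ.restrict B ≤ M • ν) {f : E n → F}
    (hf : Function.support f ⊆ B) :
    eLpNorm f 2 μ ≤ M ^ (1 / 2 : ENNReal).toReal * eLpNorm f 2 ν := by
  rw [← eLpNorm_restrict_eq_of_support_subset hf, ← smul_eq_mul,
    ← eLpNorm_smul_measure_of_ne_top (by norm_num)]
  exact eLpNorm_mono_measure f h

lemma memLp_volume_of_support_subset {F : Type*} [NormedAddCommGroup F] {Φ : E n → ℝ}
    (hΦ : Continuous Φ) {f : E n → F} (hf : MemLp f 2 (gibbs Φ)) {B : Set (E n)}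
    (hB : IsCompact B) (hfB : Function.support f ⊆ B) : MemLp f 2 volume := by
  obtain ⟨M, hM, hle⟩ := exists_volume_restrict_le hΦ hB
  refine ⟨hf.1.mono_ac ?_, (eLpNorm_le_of_restrict_le hle hfB).trans_lt ?_⟩
  · exact withDensity_absolutelyContinuous' (by fun_prop) (by simp [Real.exp_pos])
  · exact ENNReal.mul_lt_top (ENNReal.rpow_lt_top_of_nonneg (by norm_num) hM) hf.2

/-- A bump of radius at most `1` keeps the mollified function and its gradient in the ball of radius
`1 + r`, where `μ` is dominated by Lebesgue measure. One mollifier serves both estimates, since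
gradients commute with mollification. -/
lemma exists_smooth_approx_of_support_subset {Φ : E n → ℝ} (hΦ : Continuous Φ) {g : E n → ℂ}
    {g' : E n → EuclideanSpace ℂ (Fin n)} (hgg' : IsWeakGrad g g') (hg : MemLp g 2 (gibbs Φ))
    (hg' : MemLp g' 2 (gibbs Φ)) {r : ℝ} (hgs : Function.support g ⊆ Metric.closedBall 0 r)
    (hgs' : Function.support g' ⊆ Metric.closedBall 0 r) {ε : ENNReal} (hε : ε ≠ 0) :
    ∃ f : E n → ℂ, ContDiff ℝ ∞ f ∧ HasCompactSupport f ∧ eLpNorm (f - g) 2 (gibbs Φ) ≤ ε ∧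
      AEStronglyMeasurable (cgrad f) (gibbs Φ) ∧ eLpNorm (cgrad f - g') 2 (gibbs Φ) ≤ ε := by
  have hgm : MemLp g 2 volume :=
    memLp_volume_of_support_subset hΦ hg (isCompact_closedBall 0 r) hgs
  have hgm' : MemLp g' 2 volume :=
    memLp_volume_of_support_subset hΦ hg' (isCompact_closedBall 0 r) hgs'
  have hgl := hgm.locallyIntegrable (by norm_num)
  have hgl' := hgm'.locallyIntegrable (by norm_num)
  obtain ⟨M, hM, hle⟩ := exists_gibbs_restrict_le hΦ (isCompact_closedBall (0 : E n) (1 + r))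
  set M' := M ^ (1 / 2 : ENNReal).toReal with hM'
  have hM't : M' ≠ ⊤ := ENNReal.rpow_ne_top_of_nonneg (by norm_num) hM
  -- The quotient is in `ENNReal`, so `M' = 0` needs no separate treatment: `ε / M' ≠ 0` uses only
  -- `M' ≠ ⊤`, and `M' * (ε / M') ≤ ε` always holds.
  have hε' : ε / M' ≠ 0 := by
    rw [Ne, ENNReal.div_eq_zero_iff, not_or]
    exact ⟨hε, hM't⟩
  obtain ⟨δ, hδ, h1⟩ := exists_eLpNorm_mollify_sub_le hgm hε'
  obtain ⟨δ', hδ', h1'⟩ := exists_eLpNorm_mollify_sub_le hgm' hε'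
  have hδ'' : 0 < min 1 (min δ δ') := lt_min one_pos (lt_min hδ hδ')
  obtain ⟨φ, hφ⟩ : ∃ φ : ContDiffBump (0 : E n), φ.rOut = min 1 (min δ δ') :=
    ⟨⟨min 1 (min δ δ') / 2, min 1 (min δ δ'), half_pos hδ'', half_lt_self hδ''⟩, rfl⟩
  have hφ1 : φ.rOut ≤ 1 := hφ.trans_le (min_le_left _ _)
  have hφδ : φ.rOut ≤ δ := hφ.trans_le ((min_le_right _ _).trans (min_le_left _ _))
  have hφδ' : φ.rOut ≤ δ' := hφ.trans_le ((min_le_right _ _).trans (min_le_right _ _))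
  have hball : Metric.closedBall (0 : E n) (φ.rOut + r) ⊆ Metric.closedBall 0 (1 + r) :=
    Metric.closedBall_subset_closedBall (by linarith)
  have hball' : Metric.closedBall (0 : E n) r ⊆ Metric.closedBall 0 (1 + r) :=
    Metric.closedBall_subset_closedBall (by linarith)
  have hfs : Function.support (mollify φ g) ⊆ Metric.closedBall 0 (1 + r) :=
    (support_mollify_subset φ hgs).trans hball
  have hfs' : Function.support (mollify φ g') ⊆ Metric.closedBall 0 (1 + r) :=
    (support_mollify_subset φ hgs').trans hball
  have hcg : cgrad (mollify φ g) = mollify φ g' := cgrad_mollify φ hgl hgl' hgg'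
  have hfin : M' * (ε / M') ≤ ε := ENNReal.mul_div_le
  refine ⟨mollify φ g, contDiff_mollify φ hgl,
    HasCompactSupport.intro (isCompact_closedBall (0 : E n) (1 + r)) fun x hx =>
      Function.notMem_support.1 fun h => hx (hfs h), ?_, ?_, ?_⟩
  · exact (eLpNorm_le_of_restrict_le hle ((Function.support_sub _ _).trans
      (Set.union_subset hfs (hgs.trans hball')))).trans ((mul_le_mul_right (h1 φ hφδ) _).trans hfin)
  · rw [hcg]
    exact (contDiff_mollify φ hgl').continuous.aestronglyMeasurable
  · rw [hcg]
    exact (eLpNorm_le_of_restrict_le hle ((Function.support_sub _ _).trans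
      (Set.union_subset hfs' (hgs'.trans hball')))).trans
      ((mul_le_mul_right (h1' φ hφδ') _).trans hfin)

/-- Test functions are dense in `H¹(μ)`. -/
lemma exists_smooth_approx {Φ : E n → ℝ} (hΦ : Continuous Φ) {u : E n → ℂ}
    {v : E n → EuclideanSpace ℂ (Fin n)} (huv : IsWeakGrad u v) (hu : MemLp u 2 (gibbs Φ))
    (hv : MemLp v 2 (gibbs Φ)) (hul : LocallyIntegrable u volume)
    (hvl : LocallyIntegrable v volume) {ε : ENNReal} (hε : ε ≠ 0) :
    ∃ f : E n → ℂ, ContDiff ℝ ∞ f ∧ HasCompactSupport f ∧ eLpNorm (f - u) 2 (gibbs Φ) ≤ ε ∧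
      eLpNorm (cgrad f - v) 2 (gibbs Φ) ≤ ε := by
  -- Half of `ε` is for the mollification and half for the cutoff. For gradients the second half is
  -- split again, between `χ v - v` and `u ∇χ`.
  have hε2 : 0 < ε / 2 := pos_iff_ne_zero.2 (by simpa using hε)
  have hε4 : 0 < ε / 2 / 2 := pos_iff_ne_zero.2 (by simpa using hε)
  obtain ⟨k, hk1, hk2, hk3⟩ :
      ∃ k : ℕ, eLpNorm (fun x => cutoff k x • u x - u x) 2 (gibbs Φ) ≤ ε / 2 ∧
        eLpNorm (fun x => cutoff k x • v x - v x) 2 (gibbs Φ) ≤ ε / 2 / 2 ∧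
        eLpNorm (fun x => u x • rgrad (cutoff k) x) 2 (gibbs Φ) ≤ ε / 2 / 2 :=
    (((tendsto_eLpNorm_cutoff_smul_sub hu).eventually (Iic_mem_nhds hε2)).and
      (((tendsto_eLpNorm_cutoff_smul_sub hv).eventually (Iic_mem_nhds hε4)).and
      ((tendsto_eLpNorm_smul_rgrad_cutoff hu).eventually (Iic_mem_nhds hε4)))).exists
  have hχ := contDiff_cutoff (n := n) k
  have hgm := memLp_cutoff_smul hu k
  have hvm := memLp_cutoff_smul hv k
  have hrm := memLp_smul_rgrad_cutoff hu k
  obtain ⟨f, hf1, hf2, hf3, hf4, hf5⟩ := exists_smooth_approx_of_support_subset hΦ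
    (IsWeakGrad.smul huv hul hvl hχ) hgm (hvm.add hrm) (r := 2 * ((k : ℝ) + 1))
    (fun x hx => by
      by_contra h
      rw [mem_closedBall_zero_iff, not_le] at h
      exact hx (by simp [cutoff_eq_zero h]))
    (fun x hx => by
      by_contra h
      rw [mem_closedBall_zero_iff, not_le] at h
      exact hx (by simp [cutoff_eq_zero h, rgrad_cutoff_eq_zero h]))
    hε2.ne'
  refine ⟨f, hf1, hf2, ?_, ?_⟩
  · rw [← sub_add_sub_cancel _ (fun x => cutoff k x • u x)]
    refine (eLpNorm_add_le (hf1.continuous.aestronglyMeasurable.sub hgm.1) (hgm.1.sub hu.1)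
      (by norm_num)).trans ?_
    exact (add_le_add hf3 hk1).trans_eq (ENNReal.add_halves ε)
  · rw [← sub_add_sub_cancel _ (fun x => cutoff k x • v x + u x • rgrad (cutoff k) x)]
    refine (eLpNorm_add_le (hf4.sub (hvm.add hrm).1) ((hvm.add hrm).1.sub hv.1)
      (by norm_num)).trans ((add_le_add hf5 ?_).trans_eq (ENNReal.add_halves ε))
    have hsum : (fun x => cutoff k x • v x + u x • rgrad (cutoff k) x) - v =
        (fun x => cutoff k x • v x - v x) + fun x => u x • rgrad (cutoff k) x := by
      ext1 x
      simp only [Pi.sub_apply, Pi.add_apply]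
      abel
    refine (congrArg (eLpNorm · 2 (gibbs Φ)) hsum).trans_le ?_
    refine (eLpNorm_add_le (hvm.1.sub hv.1) hrm.1 (by norm_num)).trans ?_
    exact (add_le_add hk2 hk3).trans_eq (ENNReal.add_halves _)

end Density

/-! ### The Poincaré inequality on a ball -/

section LocalPoincare

variable {n : ℕ}

/-- Cauchy–Schwarz, after writing the directional derivative as the inner product of the complex
gradient with the real vector `v` regarded as a complex one. -/
lemma norm_fderiv_apply_le (f : E n → ℂ) (x v : E n) :
    ‖fderiv ℝ f x v‖ ≤ ‖v‖ * ‖cgrad f x‖ := by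
  let w : EuclideanSpace ℂ (Fin n) := WithLp.toLp 2 fun j => (v j : ℂ)
  have hw : ‖w‖ = ‖v‖ := by
    simp [EuclideanSpace.norm_eq, w]
  have h1 : fderiv ℝ f x v = inner ℂ w (cgrad f x) := by
    have hv : v = ∑ j, v j • EuclideanSpace.single j (1 : ℝ) := by
      simpa using ((EuclideanSpace.basisFun (Fin n) ℝ).sum_repr v).symm
    conv_lhs => rw [hv]
    rw [map_sum, PiLp.inner_apply]
    refine Finset.sum_congr rfl fun j _ => ?_
    rw [map_smul, Complex.real_smul]
    simp [w, cgrad, mul_comm]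
  rw [h1, ← hw]
  exact norm_inner_le_norm _ _

lemma continuous_cgrad {f : E n → ℂ} (hf : ContDiff ℝ 1 f) : Continuous (cgrad f) := by
  refine (PiLp.continuous_toLp 2 _).comp (continuous_pi fun j => ?_)
  exact (hf.continuous_fderiv (by simp)).clm_apply continuous_const

/-- The fundamental theorem of calculus on the segment from `y` to `x`, followed by Jensen on the
unit interval. -/
lemma enorm_sub_sq_le_lintegral {f : E n → ℂ} (hf : ContDiff ℝ 1 f) (x y : E n) :
    ‖f x - f y‖ₑ ^ 2 ≤
      ‖x - y‖ₑ ^ 2 * ∫⁻ t in Set.Icc (0 : ℝ) 1, ‖cgrad f (y + t • (x - y))‖ₑ ^ 2 := by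
  have hγ : ∀ t : ℝ, HasDerivAt (fun t : ℝ => y + t • (x - y)) (x - y) t := fun t => by
    simpa using ((hasDerivAt_id t).smul_const (x - y)).const_add y
  have hfγ : ∀ t : ℝ, HasDerivAt (fun t : ℝ => f (y + t • (x - y)))
      (fderiv ℝ f (y + t • (x - y)) (x - y)) t := fun t =>
    ((hf.differentiable (by simp) _).hasFDerivAt).comp_hasDerivAt t (hγ t)
  have h1 := enorm_sub_le_lintegral_derivWithin_Icc_of_contDiffOn_Icc
    (f := fun t : ℝ => f (y + t • (x - y))) (a := 0) (b := 1)
    (hf.comp (by fun_prop)).contDiffOn zero_le_one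
  simp only [one_smul, zero_smul, add_zero, add_sub_cancel] at h1
  have hcg : Continuous fun t : ℝ => cgrad f (y + t • (x - y)) :=
    (continuous_cgrad hf).comp (by fun_prop)
  have h2 : ‖f x - f y‖ₑ ≤
      ‖x - y‖ₑ * ∫⁻ t in Set.Icc (0 : ℝ) 1, ‖cgrad f (y + t • (x - y))‖ₑ := by
    rw [← lintegral_const_mul _ hcg.enorm.measurable]
    refine h1.trans (setLIntegral_mono (hcg.enorm.measurable.const_mul _) fun t ht => ?_)
    rw [(hfγ t).hasDerivWithinAt.derivWithin (uniqueDiffOn_Icc zero_lt_one t ht), ← enorm_norm,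
      ← enorm_norm (x - y), ← enorm_norm (cgrad f _), ← enorm_mul, enorm_le_iff_norm_le,
      norm_norm, norm_mul, norm_norm, norm_norm]
    exact norm_fderiv_apply_le _ _ _
  have : IsProbabilityMeasure (volume.restrict (Set.Icc (0 : ℝ) 1)) := ⟨by simp⟩
  calc _ ≤ (‖x - y‖ₑ * ∫⁻ t in Set.Icc (0 : ℝ) 1, ‖cgrad f (y + t • (x - y))‖ₑ) ^ 2 := by gcongr
    _ = ‖x - y‖ₑ ^ 2 * (∫⁻ t in Set.Icc (0 : ℝ) 1, ‖cgrad f (y + t • (x - y))‖ₑ) ^ 2 := mul_pow _ _ _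
    _ ≤ _ := by
      gcongr
      exact sq_lintegral_enorm_le hcg.aestronglyMeasurable

/-- The homothety of centre `y` and ratio `t` maps `B` into itself by convexity, and its inverse has
Jacobian `t⁻ⁿ ≤ 2ⁿ`. -/
lemma setLIntegral_comp_homothety_le {G : E n → ENNReal} (hG : Measurable G) {B : Set (E n)}
    (hB : MeasurableSet B) (hBc : Convex ℝ B) {y : E n} (hy : y ∈ B) {t : ℝ} (ht : 1 / 2 ≤ t)
    (ht1 : t ≤ 1) :
    ∫⁻ x in B, G (y + t • (x - y)) ≤ 2 ^ n * ∫⁻ x in B, G x := by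
  have ht0 : 0 < t := by linarith
  have hGB : Measurable (B.indicator G) := hG.indicator hB
  have h1 : ∫⁻ x in B, G (y + t • (x - y)) ≤ ∫⁻ x, B.indicator G ((y - t • y) + t • x) := by
    rw [← lintegral_indicator hB]
    refine lintegral_mono fun x => ?_
    by_cases hx : x ∈ B
    · have h2 : (y - t • y) + t • x = y + t • (x - y) := by module
      have h3 : y + t • (x - y) ∈ B := by
        have := hBc hy hx (sub_nonneg.2 ht1) ht0.le (by ring)
        convert this using 1
        module
      rw [Set.indicator_of_mem hx, h2, Set.indicator_of_mem h3]
    · rw [Set.indicator_of_notMem hx]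
      exact zero_le
  refine h1.trans ?_
  have hm : Measurable fun z => B.indicator G ((y - t • y) + z) :=
    hGB.comp (measurable_const_add _)
  rw [← lintegral_map (μ := volume) (g := fun x : E n => t • x) hm (by fun_prop),
    Measure.map_addHaar_smul volume ht0.ne', lintegral_smul_measure, lintegral_add_left_eq_self,
    lintegral_indicator hB, smul_eq_mul]
  gcongr
  rw [finrank_euclideanSpace_fin, abs_of_pos (by positivity), ← inv_pow]
  refine (ENNReal.ofReal_le_ofReal (q := 2 ^ n) ?_).trans_eq ?_
  · gcongr
    rw [inv_le_comm₀ ht0 two_pos]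
    linarith
  · rw [ENNReal.ofReal_pow two_pos.le]
    simp

/-- The Poincaré inequality on a ball, for the Lebesgue measure. -/
lemma lintegral_lintegral_enorm_sub_sq_le {f : E n → ℂ} (hf : ContDiff ℝ 1 f) (R : ℝ) :
    ∫⁻ x in Metric.closedBall (0 : E n) R, ∫⁻ y in Metric.closedBall (0 : E n) R,
        ‖f x - f y‖ₑ ^ 2 ≤
      ENNReal.ofReal (2 * R) ^ 2 * (2 ^ n * volume (Metric.closedBall (0 : E n) R)) *
        ∫⁻ z in Metric.closedBall (0 : E n) R, ‖cgrad f z‖ₑ ^ 2 := by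
  set B := Metric.closedBall (0 : E n) R with hBdef
  have hB : MeasurableSet B := measurableSet_closedBall
  have hBc : Convex ℝ B := convex_closedBall 0 R
  set G : E n → ENNReal := fun z => ‖cgrad f z‖ₑ ^ 2 with hGdef
  have hGc : Continuous G := (ENNReal.continuous_pow 2).comp (continuous_cgrad hf).enorm
  have hG : Measurable G := hGc.measurable
  have hfin : IsFiniteMeasure (volume.restrict B) :=
    ⟨by simpa using (isCompact_closedBall (0 : E n) R).measure_lt_top⟩
  have hmeas : ∀ t : ℝ, Measurable fun p : E n × E n => G (p.2 + t • (p.1 - p.2)) :=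
    fun t => hG.comp (by fun_prop)
  -- The point `y + t (x - y)` is a contraction of `x` towards `y` with ratio `t`, and of `y`
  -- towards `x` with ratio `1 - t`. One of the ratios is at least `1 / 2`; integrate first in the
  -- corresponding variable.
  have hlow : ∀ t ∈ Set.Icc (0 : ℝ) 1,
      ∫⁻ x in B, ∫⁻ y in B, G (y + t • (x - y)) ≤ 2 ^ n * volume B * ∫⁻ z in B, G z := by
    rintro t ⟨ht0, ht1⟩
    have hconst : ∫⁻ _ in B, 2 ^ n * ∫⁻ z in B, G z = 2 ^ n * volume B * ∫⁻ z in B, G z := by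
      rw [setLIntegral_const]; ring
    rw [← hconst]
    rcases le_total (1 / 2) t with h | h
    · rw [lintegral_lintegral_swap (hmeas t).aemeasurable]
      exact setLIntegral_mono' hB fun y hy => setLIntegral_comp_homothety_le hG hB hBc hy h ht1
    · refine setLIntegral_mono' hB fun x hx => ?_
      have := setLIntegral_comp_homothety_le hG hB hBc hx (t := 1 - t) (by linarith) (by linarith)
      refine le_trans (le_of_eq ?_) this
      congr 1 with y
      congr 1
      module
  calc ∫⁻ x in B, ∫⁻ y in B, ‖f x - f y‖ₑ ^ 2
      ≤ ∫⁻ x in B, ∫⁻ y in B, ENNReal.ofReal (2 * R) ^ 2 *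
          ∫⁻ t in Set.Icc (0 : ℝ) 1, G (y + t • (x - y)) := by
        refine setLIntegral_mono' hB fun x hx => setLIntegral_mono' hB fun y hy => ?_
        refine (enorm_sub_sq_le_lintegral hf x y).trans ?_
        gcongr
        rw [← ofReal_norm]
        refine ENNReal.ofReal_le_ofReal ?_
        rw [hBdef, mem_closedBall_zero_iff] at hx hy
        exact (norm_sub_le _ _).trans (by linarith)
    _ = ENNReal.ofReal (2 * R) ^ 2 * ∫⁻ x in B, ∫⁻ y in B,
          ∫⁻ t in Set.Icc (0 : ℝ) 1, G (y + t • (x - y)) := by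
        have h0 : ENNReal.ofReal (2 * R) ^ 2 ≠ ⊤ := by finiteness
        simp only [lintegral_const_mul' _ _ h0]
    _ = ENNReal.ofReal (2 * R) ^ 2 * ∫⁻ t in Set.Icc (0 : ℝ) 1, ∫⁻ x in B, ∫⁻ y in B,
          G (y + t • (x - y)) := by
        congr 1
        have h1 : ∀ x, ∫⁻ y in B, ∫⁻ t in Set.Icc (0 : ℝ) 1, G (y + t • (x - y)) =
            ∫⁻ t in Set.Icc (0 : ℝ) 1, ∫⁻ y in B, G (y + t • (x - y)) := fun x => by
          refine lintegral_lintegral_swap (Measurable.aemeasurable ?_)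
          exact hG.comp (g := G) (f := fun p : E n × ℝ => p.1 + p.2 • (x - p.1)) (by fun_prop)
        simp only [h1]
        refine lintegral_lintegral_swap (Measurable.aemeasurable ?_)
        refine Measurable.lintegral_prod_right'
          (f := fun q : (E n × ℝ) × E n => G (q.2 + q.1.2 • (q.1.1 - q.2))) ?_
        exact hG.comp (by fun_prop)
    _ ≤ ENNReal.ofReal (2 * R) ^ 2 * ∫⁻ t in Set.Icc (0 : ℝ) 1,
          2 ^ n * volume B * ∫⁻ z in B, G z := by
        gcongr 1
        exact setLIntegral_mono' measurableSet_Icc hlow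
    _ = _ := by
        rw [setLIntegral_const, Real.volume_Icc]
        simp
        ring

/-- Expand the square: the diagonal terms each give the total mass times `∫ |f|²`, and the cross
term factors into `|∫ f|²`. This turns the double integral into a variance. -/
lemma lintegral_lintegral_enorm_sub_sq {α : Type*} [MeasurableSpace α] {ν : Measure α}
    [IsFiniteMeasure ν] {f : α → ℂ} (hf : MemLp f 2 ν) :
    ∫⁻ x, ∫⁻ y, ‖f x - f y‖ₑ ^ 2 ∂ν ∂ν =
      ENNReal.ofReal (2 * (ν.real Set.univ * ∫ x, ‖f x‖ ^ 2 ∂ν) - 2 * ‖∫ x, f x ∂ν‖ ^ 2) := by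
  have hi : Integrable f ν := hf.integrable (by norm_num)
  have hi2 : Integrable (fun x => ‖f x‖ ^ 2) ν := by
    simpa using hf.integrable_norm_pow (p := 2) (by norm_num)
  have hexp : ∀ x y, ‖f x - f y‖ ^ 2 = ‖f x‖ ^ 2 + ‖f y‖ ^ 2 - 2 * inner ℝ (f x) (f y) :=
    fun x y => by rw [@norm_sub_sq_real]; ring
  have hin : ∀ x, Integrable (fun y => inner ℝ (f x) (f y)) ν := fun x =>
    (innerSL ℝ (f x)).integrable_comp hi
  have hA : ∀ x, Integrable (fun y => ‖f x‖ ^ 2 + ‖f y‖ ^ 2) ν :=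
    fun x => (integrable_const _).add hi2
  have hint : ∀ x, ∫ y, ‖f x - f y‖ ^ 2 ∂ν =
      ν.real Set.univ * ‖f x‖ ^ 2 + ∫ y, ‖f y‖ ^ 2 ∂ν - 2 * inner ℝ (f x) (∫ y, f y ∂ν) :=
    fun x => by
      simp only [hexp]
      rw [integral_sub (hA x) ((hin x).const_mul 2), integral_add (integrable_const _) hi2,
        integral_const, integral_const_mul, smul_eq_mul, integral_inner hi]
  have hinner : ∀ x, ∫⁻ y, ‖f x - f y‖ₑ ^ 2 ∂ν = ENNReal.ofReal
      (ν.real Set.univ * ‖f x‖ ^ 2 + ∫ y, ‖f y‖ ^ 2 ∂ν - 2 * inner ℝ (f x) (∫ y, f y ∂ν)) :=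
    fun x => by
      rw [← hint, ofReal_integral_eq_lintegral_ofReal]
      · congr 1 with y
        rw [ENNReal.ofReal_pow (norm_nonneg _), ofReal_norm]
      · simp only [hexp]
        exact (hA x).sub ((hin x).const_mul 2)
      · exact ae_of_all _ fun y => sq_nonneg _
  simp only [hinner]
  have hin' : Integrable (fun x => inner ℝ (f x) (∫ y, f y ∂ν)) ν :=
    hi.inner_const _
  have hB : Integrable (fun x => ν.real Set.univ * ‖f x‖ ^ 2 + ∫ y, ‖f y‖ ^ 2 ∂ν) ν :=
    (hi2.const_mul _).add (integrable_const _)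
  have hI : Integrable (fun x => ν.real Set.univ * ‖f x‖ ^ 2 + ∫ y, ‖f y‖ ^ 2 ∂ν -
      2 * inner ℝ (f x) (∫ y, f y ∂ν)) ν := hB.sub (hin'.const_mul 2)
  rw [← ofReal_integral_eq_lintegral_ofReal hI]
  · congr 1
    have h2 : ∫ x, inner ℝ (f x) (∫ y, f y ∂ν) ∂ν = ‖∫ y, f y ∂ν‖ ^ 2 := by
      simp only [real_inner_comm (∫ y, f y ∂ν)]
      rw [integral_inner hi, real_inner_self_eq_norm_sq]
    rw [integral_sub hB (hin'.const_mul 2), integral_add (hi2.const_mul _) (integrable_const _),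
      integral_const, integral_const_mul, integral_const_mul, h2, smul_eq_mul]
    ring
  · refine ae_of_all _ fun x => ?_
    refine le_of_le_of_eq ?_ (hint x)
    exact integral_nonneg fun y => sq_nonneg _

/-- The Lebesgue inequality is transferred by comparing densities on the ball: the upper bound `M`
enters twice, for the double integral, and the bound `M'` in the other direction once, for the
gradient. -/
lemma exists_lintegral_lintegral_gibbs_le {Φ : E n → ℝ} (hΦ : Continuous Φ) (R : ℝ) :
    ∃ k : ENNReal, k ≠ ⊤ ∧ ∀ f : E n → ℂ, ContDiff ℝ 1 f →
      ∫⁻ x in Metric.closedBall (0 : E n) R, ∫⁻ y in Metric.closedBall (0 : E n) R,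
        ‖f x - f y‖ₑ ^ 2 ∂(gibbs Φ) ∂(gibbs Φ) ≤ k * ∫⁻ z, ‖cgrad f z‖ₑ ^ 2 ∂(gibbs Φ) := by
  have hBk : IsCompact (Metric.closedBall (0 : E n) R) := isCompact_closedBall 0 R
  obtain ⟨M, hM, hle⟩ := exists_gibbs_restrict_le hΦ hBk
  obtain ⟨M', hM', hle'⟩ := exists_volume_restrict_le hΦ hBk
  have hνB : (gibbs Φ).restrict (Metric.closedBall (0 : E n) R) ≤
      M • volume.restrict (Metric.closedBall (0 : E n) R) := by
    have := Measure.restrict_mono_measure hle (Metric.closedBall (0 : E n) R)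
    rwa [Measure.restrict_restrict hBk.measurableSet, Set.inter_self,
      Measure.restrict_smul] at this
  have hvol : volume (Metric.closedBall (0 : E n) R) ≠ ⊤ := hBk.measure_lt_top.ne
  have hP := fun (f : E n → ℂ) (hf : ContDiff ℝ 1 f) => lintegral_lintegral_enorm_sub_sq_le hf R
  set K := ENNReal.ofReal (2 * R) ^ 2 * (2 ^ n * volume (Metric.closedBall (0 : E n) R)) with hK
  have hKt : K ≠ ⊤ := by finiteness
  refine ⟨M * (M * (K * M')), by finiteness, fun f hf => ?_⟩
  set B := Metric.closedBall (0 : E n) R with hBdef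
  calc ∫⁻ x in B, ∫⁻ y in B, ‖f x - f y‖ₑ ^ 2 ∂(gibbs Φ) ∂(gibbs Φ)
      ≤ ∫⁻ x, ∫⁻ y, ‖f x - f y‖ₑ ^ 2 ∂(M • volume.restrict B) ∂(M • volume.restrict B) :=
        (lintegral_mono fun x => lintegral_mono' hνB fun y => le_refl (‖f x - f y‖ₑ ^ 2)).trans
          (lintegral_mono' hνB fun x => le_refl _)
    _ = M * (M * ∫⁻ x in B, ∫⁻ y in B, ‖f x - f y‖ₑ ^ 2) := by
        simp only [lintegral_smul_measure, smul_eq_mul]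
        rw [lintegral_const_mul' _ _ hM]
    _ ≤ M * (M * (K * ∫⁻ z in B, ‖cgrad f z‖ₑ ^ 2)) :=
        mul_le_mul_right (mul_le_mul_right (hP f hf) _) _
    _ ≤ M * (M * (K * ∫⁻ z, ‖cgrad f z‖ₑ ^ 2 ∂(M' • gibbs Φ))) :=
        mul_le_mul_right (mul_le_mul_right (mul_le_mul_right
          (lintegral_mono' hle' le_rfl) _) _) _
    _ = M * (M * (K * M')) * ∫⁻ z, ‖cgrad f z‖ₑ ^ 2 ∂(gibbs Φ) := by
        rw [lintegral_smul_measure, smul_eq_mul]; ring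

lemma hasCompactSupport_cgrad {f : E n → ℂ} (hfs : HasCompactSupport f) :
    HasCompactSupport (cgrad f) := by
  refine HasCompactSupport.intro hfs.isCompact fun x hx => ?_
  ext j
  change fderiv ℝ f x _ = 0
  rw [image_eq_zero_of_notMem_tsupport fun h => hx (tsupport_fderiv_subset ℝ h)]
  rfl

lemma isLocallyFiniteMeasure_gibbs {Φ : E n → ℝ} (hΦ : Continuous Φ) :
    IsLocallyFiniteMeasure (gibbs Φ) :=
  IsLocallyFiniteMeasure.withDensity_ofReal (by fun_prop)

lemma integrable_norm_sq_gibbs {F : Type*} [NormedAddCommGroup F] {Φ : E n → ℝ}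
    (hΦ : Continuous Φ) {f : E n → F} (hf : Continuous f) (hfs : HasCompactSupport f) :
    Integrable (fun x => ‖f x‖ ^ 2) (gibbs Φ) := by
  have := isLocallyFiniteMeasure_gibbs hΦ
  refine (hf.norm.pow 2).integrable_of_hasCompactSupport ?_
  refine HasCompactSupport.intro hfs.isCompact fun x hx => ?_
  change ‖f x‖ ^ 2 = 0
  rw [image_eq_zero_of_notMem_tsupport hx, norm_zero, zero_pow two_ne_zero]

lemma measureReal_closedBall_gibbs_pos {Φ : E n → ℝ} (hΦ : Continuous Φ) {R : ℝ} (hR : 0 < R) :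
    0 < (gibbs Φ).real (Metric.closedBall 0 R) := by
  have := isLocallyFiniteMeasure_gibbs hΦ
  rw [measureReal_def, ENNReal.toReal_pos_iff]
  refine ⟨?_, (isCompact_closedBall 0 R).measure_lt_top⟩
  have h1 : 0 < volume (Metric.closedBall (0 : E n) R) := Metric.measure_closedBall_pos _ _ hR
  rw [pos_iff_ne_zero]
  intro h2
  have h3 : volume ≪ gibbs Φ :=
    withDensity_absolutelyContinuous' (by fun_prop) (by simp [Real.exp_pos])
  exact h1.ne' (h3 h2)

/-- The Poincaré inequality on a ball, for the measure `μ`. -/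
lemma exists_integral_ball_norm_sq_le {Φ : E n → ℝ} (hΦ : Continuous Φ) {R : ℝ} (hR : 0 < R) :
    ∃ κ : ℝ, 0 ≤ κ ∧ ∀ f : E n → ℂ, ContDiff ℝ 1 f → HasCompactSupport f →
      ∫ x in Metric.closedBall (0 : E n) R, ‖f x‖ ^ 2 ∂(gibbs Φ) ≤
        κ * ∫ x, ‖cgrad f x‖ ^ 2 ∂(gibbs Φ) +
        κ * ‖∫ x in Metric.closedBall (0 : E n) R, f x ∂(gibbs Φ)‖ ^ 2 := by
  have hloc := isLocallyFiniteMeasure_gibbs hΦ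
  obtain ⟨k, hk, hle⟩ := exists_lintegral_lintegral_gibbs_le hΦ R
  set ν := (gibbs Φ).restrict (Metric.closedBall (0 : E n) R) with hν
  have hνfin : IsFiniteMeasure ν := ⟨by
    rw [hν, Measure.restrict_apply_univ]
    exact (isCompact_closedBall 0 R).measure_lt_top⟩
  have hm : 0 < ν.real Set.univ := by
    rw [hν, measureReal_restrict_apply_univ]
    exact measureReal_closedBall_gibbs_pos hΦ hR
  set m := ν.real Set.univ with hmdef
  obtain ⟨k, rfl⟩ : ∃ k' : NNReal, k = k' := ⟨k.toNNReal, (ENNReal.coe_toNNReal hk).symm⟩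
  -- The double integral equals `2 m ∫ |f|² - 2 |∫ f|²`. Dividing its bound by `2 m` produces the
  -- two coefficients `k / (2 m)` and `1 / m`.
  refine ⟨max ((k : ℝ) / (2 * m)) m⁻¹, le_max_of_le_right (by positivity), fun f hf hfs => ?_⟩
  have hcgi := integrable_norm_sq_gibbs hΦ (continuous_cgrad hf) (hasCompactSupport_cgrad hfs)
  have hfm : MemLp f 2 ν := (hf.continuous.memLp_of_hasCompactSupport hfs).mono_measure
    (Measure.restrict_le_self (μ := gibbs Φ))
  have hI0 : 0 ≤ ∫ x, ‖cgrad f x‖ ^ 2 ∂(gibbs Φ) := integral_nonneg fun _ => sq_nonneg _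
  have h2 : ENNReal.ofReal (k * ∫ x, ‖cgrad f x‖ ^ 2 ∂(gibbs Φ)) =
      k * ∫⁻ z, ‖cgrad f z‖ₑ ^ 2 ∂(gibbs Φ) := by
    rw [ENNReal.ofReal_mul (NNReal.coe_nonneg k), ENNReal.ofReal_coe_nnreal,
      ofReal_integral_eq_lintegral_ofReal hcgi (ae_of_all _ fun _ => sq_nonneg _)]
    congr 2 with z
    rw [ENNReal.ofReal_pow (norm_nonneg _), ofReal_norm]
  have h1 := hle f hf
  rw [lintegral_lintegral_enorm_sub_sq hfm, ← h2,
    ENNReal.ofReal_le_ofReal_iff (mul_nonneg (NNReal.coe_nonneg k) hI0)] at h1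
  calc ∫ x, ‖f x‖ ^ 2 ∂ν
      ≤ k / (2 * m) * ∫ x, ‖cgrad f x‖ ^ 2 ∂(gibbs Φ) + m⁻¹ * ‖∫ x, f x ∂ν‖ ^ 2 := by
        rw [div_mul_eq_mul_div, ← div_eq_inv_mul, div_add_div _ _ (by positivity) hm.ne',
          le_div_iff₀ (by positivity)]
        nlinarith
    _ ≤ _ := by
        gcongr
        · exact le_max_left _ _
        · exact le_max_right _ _

end LocalPoincare

/-! ### The Lyapunov estimate and the Poincaré inequality for test functions -/

section Lyapunov

open Filter Topology

variable {n : ℕ}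

lemma integral_gibbs {F : Type*} [NormedAddCommGroup F] [NormedSpace ℝ F] {Φ : E n → ℝ}
    (hΦ : Continuous Φ) (g : E n → F) : ∫ x, g x ∂(gibbs Φ) = ∫ x, Real.exp (-Φ x) • g x := by
  rw [gibbs, integral_withDensity_eq_integral_toReal_smul (by fun_prop) (by simp)]
  refine integral_congr_ae (ae_of_all _ fun x => ?_)
  change (ENNReal.ofReal (Real.exp (-Φ x))).toReal • g x = _
  rw [ENNReal.toReal_ofReal (Real.exp_pos _).le]

/-- The second derivative of `Φ` in the direction `v`. -/
def deriv₂ (Φ : E n → ℝ) (v x : E n) : ℝ := fderiv ℝ (fun y => fderiv ℝ Φ y v) x v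

lemma continuous_fderiv_apply {F : Type*} [NormedAddCommGroup F] [NormedSpace ℝ F] {f : E n → F}
    (hf : ContDiff ℝ 1 f) (v : E n) : Continuous fun x => fderiv ℝ f x v :=
  (hf.continuous_fderiv (by simp)).clm_apply continuous_const

lemma contDiff_fderiv_apply {Φ : E n → ℝ} (hΦ : ContDiff ℝ 2 Φ) (v : E n) :
    ContDiff ℝ 1 fun x => fderiv ℝ Φ x v :=
  (hΦ.fderiv_right (m := 1) (by norm_num)).clm_apply contDiff_const

lemma continuous_deriv₂ {Φ : E n → ℝ} (hΦ : ContDiff ℝ 2 Φ) (v : E n) :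
    Continuous (deriv₂ Φ v) :=
  continuous_fderiv_apply (contDiff_fderiv_apply hΦ v) v

/-- The one-directional form of the Lyapunov estimate with the function `exp (Φ / 2)`. -/
lemma integral_norm_sq_mul_le_directional {Φ : E n → ℝ} (hΦ : ContDiff ℝ 2 Φ) {f : E n → ℂ}
    (hf : ContDiff ℝ 1 f) (hfs : HasCompactSupport f) (v : E n) :
    ∫ x, ((1 / 4) * fderiv ℝ Φ x v ^ 2 - (1 / 2) * deriv₂ Φ v x) * ‖f x‖ ^ 2 ∂(gibbs Φ) ≤
      ∫ x, ‖fderiv ℝ f x v‖ ^ 2 ∂(gibbs Φ) := by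
  have hΦc := hΦ.continuous
  have hfc := hf.continuous
  have hf' := continuous_fderiv_apply hf v
  have hΦ' := continuous_fderiv_apply (hΦ.of_le one_le_two) v
  have hΦ'' := continuous_deriv₂ hΦ v
  have hfs' : ∀ x, x ∉ tsupport f → fderiv ℝ f x v = 0 := fun x hx => by
    rw [image_eq_zero_of_notMem_tsupport fun h => hx (tsupport_fderiv_subset ℝ h)]; rfl
  have hint : ∀ g : E n → ℝ, Continuous g → (∀ x, x ∉ tsupport f → g x = 0) → Integrable g volume :=
    fun g hg h0 => hg.integrable_of_hasCompactSupport (HasCompactSupport.intro hfs.isCompact h0)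
  rw [integral_gibbs hΦc, integral_gibbs hΦc, ← sub_nonneg]
  simp only [smul_eq_mul]
  let F : E n → ℝ := fun x => ‖f x‖ ^ 2 * Real.exp (-Φ x)
  let F' : E n → ℝ := fun x => 2 * inner ℝ (f x) (fderiv ℝ f x v) * Real.exp (-Φ x) -
    ‖f x‖ ^ 2 * Real.exp (-Φ x) * fderiv ℝ Φ x v
  have hFd : ∀ x, HasFDerivAt F (‖f x‖ ^ 2 • (Real.exp (-Φ x) • -fderiv ℝ Φ x) +
      Real.exp (-Φ x) • (2 • (innerSL ℝ (f x)).comp (fderiv ℝ f x))) x := fun x => by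
    have h1 := ((hf.differentiable (by simp) x).hasFDerivAt).norm_sq
    have h2 := ((hΦ.differentiable (by simp) x).hasFDerivAt).neg.exp
    exact h1.mul h2
  have hF' : ∀ x, fderiv ℝ F x v = F' x := fun x => by
    rw [(hFd x).fderiv]
    simp [F']
    ring
  have hz : ∀ x, x ∉ tsupport f → f x = 0 := fun x hx => image_eq_zero_of_notMem_tsupport hx
  -- Integration by parts between `F = |f|² e^{-Φ}` and `∂_v Φ`; no boundary term appears because
  -- `f` has compact support.
  have hibp : ∫ x, F x * deriv₂ Φ v x = -∫ x, F' x * fderiv ℝ Φ x v := by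
    have := integral_mul_fderiv_eq_neg_fderiv_mul_of_integrable (μ := (volume : Measure (E n)))
      (f := F) (g := fun x => fderiv ℝ Φ x v) (v := v) ?_ ?_ ?_
      (fun x _ => (hFd x).differentiableAt)
      (fun x _ => (contDiff_fderiv_apply hΦ v).differentiable (by simp) x)
    · simp only [hF'] at this
      exact this
    · simp only [hF']
      exact hint _ (by fun_prop) fun x hx => by simp [F', hz x hx]
    · exact hint _ (Continuous.mul (by fun_prop) hΦ'') fun x hx => by simp [F, hz x hx]
    · exact hint _ (by fun_prop) fun x hx => by simp [F, hz x hx]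
  have hi1 : Integrable (fun x => Real.exp (-Φ x) * ‖fderiv ℝ f x v‖ ^ 2) volume :=
    hint _ (by fun_prop) fun x hx => by simp [hfs' x hx]
  have hi2 : Integrable (fun x => Real.exp (-Φ x) *
      (((1 / 4) * fderiv ℝ Φ x v ^ 2 - (1 / 2) * deriv₂ Φ v x) * ‖f x‖ ^ 2)) volume :=
    hint _ (by fun_prop) fun x hx => by simp [hz x hx]
  have hi3 : Integrable (fun x => F x * deriv₂ Φ v x) volume :=
    hint _ (by fun_prop) fun x hx => by simp [F, hz x hx]
  have hi4 : Integrable (fun x => F' x * fderiv ℝ Φ x v) volume :=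
    hint _ (by fun_prop) fun x hx => by simp [F', hz x hx]
  have hi5 : Integrable (fun x => F x * deriv₂ Φ v x + F' x * fderiv ℝ Φ x v) volume := hi3.add hi4
  have hzero : ∫ x, (F x * deriv₂ Φ v x + F' x * fderiv ℝ Φ x v) = 0 := by
    rw [integral_add hi3 hi4, hibp, neg_add_cancel]
  -- Completing the square: the integrand on the left is `|∂_v (e^{-Φ/2} f)|²`. Half of the
  -- vanishing integral `hzero` is added to remove the cross term.
  have hsq : ∫ x, Real.exp (-Φ x) * ‖fderiv ℝ f x v - ((1 / 2) * fderiv ℝ Φ x v) • f x‖ ^ 2 =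
      (∫ x, Real.exp (-Φ x) * ‖fderiv ℝ f x v‖ ^ 2) - ∫ x, Real.exp (-Φ x) *
        (((1 / 4) * fderiv ℝ Φ x v ^ 2 - (1 / 2) * deriv₂ Φ v x) * ‖f x‖ ^ 2) := by
    rw [← sub_zero (∫ x, Real.exp (-Φ x) * ‖fderiv ℝ f x v - _‖ ^ 2),
      ← mul_zero (-(1 / 2) : ℝ), ← hzero, ← integral_const_mul, ← integral_sub hi1 hi2,
      ← integral_sub _ (hi5.const_mul _)]
    · congr 1 with x
      rw [@norm_sub_sq_real, norm_smul, mul_pow, Real.norm_eq_abs, sq_abs, inner_smul_right,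
        real_inner_comm]
      simp only [F, F']
      ring
    · exact hint _ (by fun_prop) fun x hx => by simp [hz x hx, hfs' x hx]
  rw [← hsq]
  exact integral_nonneg fun x => by positivity

/-- The potential `|Φ'|² / 4 - ΔΦ / 2` of the Schrödinger operator that is unitarily equivalent
to `A₀`. -/
def schrodingerPotential (Φ : E n → ℝ) (x : E n) : ℝ :=
  ∑ j, ((1 / 4) * fderiv ℝ Φ x (EuclideanSpace.single j 1) ^ 2 -
    (1 / 2) * deriv₂ Φ (EuclideanSpace.single j 1) x)

/-- The factor `1 / 2` is the reason why the hypothesis with constant `c` bounds the potential below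
by `c / 2`. -/
lemma schrodingerPotential_eq {Φ : E n → ℝ} (hΦ : ContDiff ℝ 2 Φ) (x : E n) :
    schrodingerPotential Φ x =
      (1 / 2) * ((1 / 2) * ‖gradient Φ x‖ ^ 2 - Laplacian.laplacian Φ x) := by
  have h1 : ‖gradient Φ x‖ ^ 2 = ∑ j, fderiv ℝ Φ x (EuclideanSpace.single j 1) ^ 2 := by
    rw [EuclideanSpace.norm_sq_eq]
    refine Finset.sum_congr rfl fun j _ => ?_
    rw [Real.norm_eq_abs, sq_abs]
    congr 1
    have h2 := InnerProductSpace.toDual_symm_apply (𝕜 := ℝ) (x := EuclideanSpace.single j (1 : ℝ))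
      (y := fderiv ℝ Φ x)
    rw [← h2, EuclideanSpace.inner_single_right]
    simp [gradient]
  have h2 : Laplacian.laplacian Φ x = ∑ j, deriv₂ Φ (EuclideanSpace.single j 1) x := by
    rw [InnerProductSpace.laplacian_eq_iteratedFDeriv_orthonormalBasis Φ
      (EuclideanSpace.basisFun (Fin n) ℝ)]
    refine Finset.sum_congr rfl fun j _ => ?_
    rw [iteratedFDeriv_two_apply]
    have h3 : DifferentiableAt ℝ (fderiv ℝ Φ) x :=
      (hΦ.fderiv_right (m := 1) (by norm_num)).differentiable (by simp) x
    unfold deriv₂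
    rw [fderiv_clm_apply h3 (differentiableAt_const _)]
    simp
  rw [h1, h2, schrodingerPotential, Finset.sum_sub_distrib, ← Finset.mul_sum, ← Finset.mul_sum]
  ring

lemma continuous_schrodingerPotential {Φ : E n → ℝ} (hΦ : ContDiff ℝ 2 Φ) :
    Continuous (schrodingerPotential Φ) := by
  refine continuous_finsetSum _ fun j _ => ?_
  have h1 := continuous_fderiv_apply (hΦ.of_le one_le_two) (EuclideanSpace.single j 1)
  have h2 := continuous_deriv₂ hΦ (EuclideanSpace.single j 1)
  fun_prop

/-- Sum the directional estimate over the standard basis. -/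
lemma integral_schrodingerPotential_mul_le {Φ : E n → ℝ} (hΦ : ContDiff ℝ 2 Φ) {f : E n → ℂ}
    (hf : ContDiff ℝ 1 f) (hfs : HasCompactSupport f) :
    ∫ x, schrodingerPotential Φ x * ‖f x‖ ^ 2 ∂(gibbs Φ) ≤ ∫ x, ‖cgrad f x‖ ^ 2 ∂(gibbs Φ) := by
  have hloc := isLocallyFiniteMeasure_gibbs hΦ.continuous
  have hfc := hf.continuous
  have h1 : ∀ x, ‖cgrad f x‖ ^ 2 = ∑ j, ‖fderiv ℝ f x (EuclideanSpace.single j 1)‖ ^ 2 :=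
    fun x => EuclideanSpace.norm_sq_eq _
  simp only [h1, schrodingerPotential, Finset.sum_mul]
  rw [integral_finsetSum, integral_finsetSum]
  · exact Finset.sum_le_sum fun j _ => integral_norm_sq_mul_le_directional hΦ hf hfs _
  · intro j _
    refine integrable_norm_sq_gibbs hΦ.continuous (continuous_fderiv_apply hf _) ?_
    exact hfs.fderiv_apply ℝ _
  · intro j _
    have h1 := continuous_fderiv_apply (hΦ.of_le one_le_two) (EuclideanSpace.single j 1)
    have h2 := continuous_deriv₂ hΦ (EuclideanSpace.single j 1)
    refine Continuous.integrable_of_hasCompactSupport (by fun_prop)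
      (HasCompactSupport.intro hfs.isCompact fun x hx => ?_)
    rw [image_eq_zero_of_notMem_tsupport hx]
    simp

/-- A Poincaré inequality for test functions, with the mean value over a ball as a remainder. -/
lemma exists_integral_norm_sq_le {Φ : E n → ℝ} (hΦ : ContDiff ℝ 2 Φ) {c : ℝ} (hc : 0 < c)
    (hinfty : ∀ᶠ x in cocompact (E n),
      c ≤ (1 / 2) * ‖gradient Φ x‖ ^ 2 - Laplacian.laplacian Φ x) :
    ∃ R > 0, ∃ C ≥ 0, ∀ f : E n → ℂ, ContDiff ℝ 1 f → HasCompactSupport f →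
      ∫ x, ‖f x‖ ^ 2 ∂(gibbs Φ) ≤ C * ∫ x, ‖cgrad f x‖ ^ 2 ∂(gibbs Φ) +
        C * ‖∫ x in Metric.closedBall (0 : E n) R, f x ∂(gibbs Φ)‖ ^ 2 := by
  obtain ⟨K, hK, hKc⟩ := mem_cocompact.1 hinfty
  obtain ⟨R, hR, hKR⟩ := hK.isBounded.subset_closedBall_lt 0 0
  have hBk : IsCompact (Metric.closedBall (0 : E n) R) := isCompact_closedBall 0 R
  obtain ⟨b, hb⟩ := hBk.exists_bound_of_continuousOn
    (continuous_schrodingerPotential hΦ).continuousOn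
  obtain ⟨κ, hκ, hloc⟩ := exists_integral_ball_norm_sq_le hΦ.continuous hR
  set B := Metric.closedBall (0 : E n) R with hB
  have hb0 : 0 ≤ b := (norm_nonneg _).trans (hb 0 (Metric.mem_closedBall_self hR.le))
  -- On the ball the potential is at least `-b`, so raising it there by `b + c / 2` gives the lower
  -- bound `c / 2` everywhere.
  have hW : ∀ x, c / 2 ≤ schrodingerPotential Φ x + B.indicator (fun _ => b + c / 2) x := by
    intro x
    by_cases hx : x ∈ B
    · rw [Set.indicator_of_mem hx]
      have := (abs_le.1 (hb x hx)).1
      linarith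
    · rw [Set.indicator_of_notMem hx, add_zero, schrodingerPotential_eq hΦ]
      have : c ≤ (1 / 2) * ‖gradient Φ x‖ ^ 2 - Laplacian.laplacian Φ x :=
        hKc fun h => hx (hKR h)
      linarith
  -- With `I = ∫ |f|²`, `D = ∫ |∇f|²` and `m = |∫_B f|²`, the estimates give `(c / 2) I ≤ D + (b + c
  -- / 2) κ (D + m)`. The constant results on enlarging the right side to a multiple of `D + m`.
  refine ⟨R, hR, 2 / c * (1 + (b + c / 2) * κ), by positivity, fun f hf hfs => ?_⟩
  have hmeas := isLocallyFiniteMeasure_gibbs hΦ.continuous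
  have h1 := integral_schrodingerPotential_mul_le hΦ hf hfs
  have h2 := hloc f hf hfs
  have hi := integrable_norm_sq_gibbs hΦ.continuous hf.continuous hfs
  have hiW : Integrable (fun x => schrodingerPotential Φ x * ‖f x‖ ^ 2) (gibbs Φ) := by
    refine Continuous.integrable_of_hasCompactSupport
      ((continuous_schrodingerPotential hΦ).mul (hf.continuous.norm.pow 2))
      (HasCompactSupport.intro hfs.isCompact fun x hx => ?_)
    rw [image_eq_zero_of_notMem_tsupport hx]
    simp
  have h3 : c / 2 * ∫ x, ‖f x‖ ^ 2 ∂(gibbs Φ) ≤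
      ∫ x, schrodingerPotential Φ x * ‖f x‖ ^ 2 ∂(gibbs Φ) +
        (b + c / 2) * ∫ x in B, ‖f x‖ ^ 2 ∂(gibbs Φ) := by
    rw [← integral_const_mul, ← integral_const_mul, ← integral_indicator hBk.measurableSet,
      ← integral_add hiW ((hi.const_mul _).indicator hBk.measurableSet)]
    refine integral_mono (hi.const_mul _)
      (hiW.add ((hi.const_mul _).indicator hBk.measurableSet)) fun x => ?_
    have h4 : B.indicator (fun x => (b + c / 2) * ‖f x‖ ^ 2) x =
        B.indicator (fun _ => b + c / 2) x * ‖f x‖ ^ 2 := by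
      by_cases hx : x ∈ B <;> simp [hx]
    change c / 2 * ‖f x‖ ^ 2 ≤ schrodingerPotential Φ x * ‖f x‖ ^ 2 +
      B.indicator (fun x => (b + c / 2) * ‖f x‖ ^ 2) x
    rw [h4, ← add_mul]
    gcongr
    exact hW x
  set I := ∫ x, ‖f x‖ ^ 2 ∂(gibbs Φ)
  set D := ∫ x, ‖cgrad f x‖ ^ 2 ∂(gibbs Φ)
  set J := ∫ x in B, ‖f x‖ ^ 2 ∂(gibbs Φ)
  set m := ‖∫ x in B, f x ∂(gibbs Φ)‖ ^ 2
  have hm : 0 ≤ m := sq_nonneg _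
  have h5 : (b + c / 2) * J ≤ (b + c / 2) * (κ * D + κ * m) := by gcongr
  have h6 : c / 2 * I ≤ (1 + (b + c / 2) * κ) * (D + m) := by nlinarith
  calc I = 2 / c * (c / 2 * I) := by field_simp
    _ ≤ 2 / c * ((1 + (b + c / 2) * κ) * (D + m)) := by gcongr
    _ = _ := by ring

end Lyapunov

/-! ### The operators `d₀` and `d₁`: closedness, dense domains, `d₁ d₀ = 0` -/

section Concrete

variable {n : ℕ} {Φ : E n → ℝ}

lemma d₀_graph (hΦ : Continuous Φ) : (d₀ Φ hΦ).graph = d₀Graph Φ hΦ :=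
  Submodule.toLinearPMap_graph_eq _ (d₀Graph_singleValued hΦ)

lemma d₁_graph (hΦ : Continuous Φ) : (d₁ Φ hΦ).graph = d₁Graph Φ hΦ :=
  Submodule.toLinearPMap_graph_eq _ (d₁Graph_singleValued hΦ)

lemma mem_d₀_domain (hΦ : Continuous Φ) {u : Forms₀ Φ} {v : Forms₁ Φ} (h : (u, v) ∈ d₀Graph Φ hΦ) :
    u ∈ (d₀ Φ hΦ).domain :=
  LinearPMap.mem_domain_of_mem_graph (by rwa [d₀_graph])

lemma d₀_mem_graph (hΦ : Continuous Φ) (u : (d₀ Φ hΦ).domain) :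
    ((u : Forms₀ Φ), d₀ Φ hΦ u) ∈ d₀Graph Φ hΦ := by
  rw [← d₀_graph]
  exact LinearPMap.mem_graph _ u

lemma exists_d₁_apply_eq (hΦ : Continuous Φ) {v : Forms₁ Φ} {w : Forms₂ Φ}
    (h : (v, w) ∈ d₁Graph Φ hΦ) : ∃ hv : v ∈ (d₁ Φ hΦ).domain, d₁ Φ hΦ ⟨v, hv⟩ = w := by
  rw [← d₁_graph, LinearPMap.mem_graph_iff] at h
  obtain ⟨y, rfl, hy⟩ := h
  exact ⟨y.2, hy⟩

lemma pairing_toLp (hΦ : Continuous Φ) {F : Type*} [NormedAddCommGroup F] {f : E n → F}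
    (hf : MemLp f 2 (gibbs Φ)) (ℓ : F → ℂ) (ψ : E n → ℝ) :
    pairing (fun x => ℓ (hf.toLp f x)) ψ = pairing (fun x => ℓ (f x)) ψ := by
  refine integral_congr_ae ?_
  filter_upwards [ae_volume_of_ae_gibbs hΦ hf.coeFn_toLp] with x hx
  rw [hx]

lemma continuous_weight_smul {F : Type*} [NormedAddCommGroup F] [NormedSpace ℂ F]
    (hΦ : Continuous Φ) {ψ : E n → ℝ} (hψ : Continuous ψ) (w : F) :
    Continuous fun x => ((ψ x * Real.exp (Φ x) : ℝ) : ℂ) • w := by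
  fun_prop

lemma memLp_weight_smul {F : Type*} [NormedAddCommGroup F] [NormedSpace ℂ F]
    (hΦ : Continuous Φ) {ψ : E n → ℝ} (hψ : Continuous ψ) (hs : HasCompactSupport ψ) (w : F) :
    MemLp (fun x => ((ψ x * Real.exp (Φ x) : ℝ) : ℂ) • w) 2 (gibbs Φ) := by
  have := isLocallyFiniteMeasure_gibbs hΦ
  refine (continuous_weight_smul hΦ hψ w).memLp_of_hasCompactSupport ?_
  refine HasCompactSupport.intro hs.isCompact fun x hx => ?_
  rw [image_eq_zero_of_notMem_tsupport hx]
  simp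

/-- The element `ψ e^Φ w` of `L²(μ)`, for a continuous function `ψ` with compact support. -/
def weightForm {F : Type*} [NormedAddCommGroup F] [NormedSpace ℂ F] (hΦ : Continuous Φ)
    {ψ : E n → ℝ} (hψ : Continuous ψ) (hs : HasCompactSupport ψ) (w : F) : Lp F 2 (gibbs Φ) :=
  (memLp_weight_smul hΦ hψ hs w).toLp _

/-- The factor `e^Φ` cancels the weight of `μ`. Distributional pairings thereby become inner
products in `L²(μ)`, hence continuous functionals. -/
lemma inner_weightForm {F : Type*} [NormedAddCommGroup F] [InnerProductSpace ℂ F]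
    (hΦ : Continuous Φ) {ψ : E n → ℝ} (hψ : Continuous ψ) (hs : HasCompactSupport ψ) (w : F)
    (f : Lp F 2 (gibbs Φ)) :
    inner ℂ (weightForm hΦ hψ hs w) f = pairing (fun x => inner ℂ w (f x)) ψ := by
  rw [L2.inner_def, pairing]
  have h1 : ∫ x, inner ℂ (weightForm hΦ hψ hs w x) (f x) ∂(gibbs Φ) =
      ∫ x, (ψ x * Real.exp (Φ x)) • inner ℂ w (f x) ∂(gibbs Φ) := by
    refine integral_congr_ae ?_
    filter_upwards [(memLp_weight_smul hΦ hψ hs w).coeFn_toLp] with x hx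
    rw [weightForm, hx, inner_smul_left, Complex.conj_ofReal, Complex.real_smul]
  rw [h1, integral_gibbs hΦ]
  congr 1 with x
  rw [smul_smul, mul_comm (ψ x), ← mul_assoc, ← Real.exp_add]
  simp

lemma inner_weightForm_one (hΦ : Continuous Φ) {ψ : E n → ℝ} (hψ : Continuous ψ)
    (hs : HasCompactSupport ψ) (u : Forms₀ Φ) :
    inner ℂ (weightForm hΦ hψ hs (1 : ℂ)) u = pairing (fun x => u x) ψ := by
  rw [inner_weightForm]
  simp

lemma inner_weightForm_single (hΦ : Continuous Φ) {ψ : E n → ℝ} (hψ : Continuous ψ)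
    (hs : HasCompactSupport ψ) {ι : Type*} [Fintype ι] [DecidableEq ι] (i : ι)
    (v : Lp (EuclideanSpace ℂ ι) 2 (gibbs Φ)) :
    inner ℂ (weightForm hΦ hψ hs (EuclideanSpace.single i (1 : ℂ))) v =
      pairing (fun x => v x i) ψ := by
  rw [inner_weightForm]
  simp [EuclideanSpace.inner_single_left]

/-- Each weak derivative condition equates two continuous functionals, and the graph is the
intersection of these closed sets. -/
lemma isClosed_d₀_graph (hΦ : Continuous Φ) :
    IsClosed ((d₀ Φ hΦ).graph : Set (Forms₀ Φ × Forms₁ Φ)) := by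
  rw [d₀_graph]
  have : (d₀Graph Φ hΦ : Set (Forms₀ Φ × Forms₁ Φ)) =
      ⋂ (j : Fin n) (φ : E n → ℝ) (h : ContDiff ℝ ∞ φ) (hs : HasCompactSupport φ),
        {p | inner ℂ (weightForm hΦ (continuous_partialDeriv h j)
            (hasCompactSupport_partialDeriv hs j) (1 : ℂ)) p.1 =
          -inner ℂ (weightForm hΦ h.continuous hs (EuclideanSpace.single j (1 : ℂ))) p.2} := by
    ext p
    simp only [Set.mem_iInter, Set.mem_ofPred_eq, inner_weightForm_one, inner_weightForm_single]
    rfl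
  rw [this]
  refine isClosed_iInter fun j => isClosed_iInter fun φ => isClosed_iInter fun h =>
    isClosed_iInter fun hs => isClosed_eq (by fun_prop) (by fun_prop)

lemma integral_partialDeriv_smul_eq {F : Type*} [NormedAddCommGroup F] [NormedSpace ℝ F]
    {φ : E n → ℝ} (hφ : ContDiff ℝ ∞ φ) (hs : HasCompactSupport φ) {f : E n → F}
    (hf : ContDiff ℝ 1 f) (j : Fin n) :
    ∫ x, partialDeriv j φ x • f x = -∫ x, φ x • fderiv ℝ f x (EuclideanSpace.single j 1) := by
  have hφ' := continuous_partialDeriv hφ j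
  have hf' := continuous_fderiv_apply hf (EuclideanSpace.single j 1)
  have h := integral_smul_fderiv_eq_neg_fderiv_smul_of_integrable
    (μ := (volume : Measure (E n))) (f := φ) (g := f) (v := EuclideanSpace.single j 1)
    ((hφ'.smul hf.continuous).integrable_of_hasCompactSupport
      (hasCompactSupport_partialDeriv hs j).smul_right)
    ((hφ.continuous.smul hf').integrable_of_hasCompactSupport hs.smul_right)
    ((hφ.continuous.smul hf.continuous).integrable_of_hasCompactSupport hs.smul_right)
    (fun x _ => hφ.differentiable (by simp) x) (fun x _ => hf.differentiable (by simp) x)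
  rw [h, neg_neg]
  rfl

lemma isWeakGrad_cgrad {f : E n → ℂ} (hf : ContDiff ℝ 1 f) : IsWeakGrad f (cgrad f) :=
  fun j _ hφ hs => integral_partialDeriv_smul_eq hφ hs hf j

lemma memLp_cgrad (hΦ : Continuous Φ) {f : E n → ℂ} (hf : ContDiff ℝ 1 f)
    (hfs : HasCompactSupport f) : MemLp (cgrad f) 2 (gibbs Φ) := by
  have := isLocallyFiniteMeasure_gibbs hΦ
  exact (continuous_cgrad hf).memLp_of_hasCompactSupport (hasCompactSupport_cgrad hfs)

lemma toLp_mem_d₀Graph (hΦ : Continuous Φ) {u : E n → ℂ} {v : E n → EuclideanSpace ℂ (Fin n)}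
    (hu : MemLp u 2 (gibbs Φ)) (hv : MemLp v 2 (gibbs Φ)) (h : IsWeakGrad u v) :
    (hu.toLp u, hv.toLp v) ∈ d₀Graph Φ hΦ := by
  intro j φ hφ hs
  have h1 := pairing_toLp hΦ hu id (partialDeriv j φ)
  have h2 := pairing_toLp hΦ hv (fun z => z j) φ
  exact h1.trans ((h j φ hφ hs).trans (congrArg Neg.neg h2.symm))

lemma contDiff_weight (hΦ : ContDiff ℝ 2 Φ) {ψ : E n → ℝ} (hψ : ContDiff ℝ ∞ ψ) :
    ContDiff ℝ 1 fun x => ψ x * Real.exp (Φ x) :=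
  (hψ.of_le (by simp)).mul (hΦ.of_le one_le_two).exp

/-- `ψ e^Φ` is `C¹` with compact support, so its classical gradient is its weak gradient and is
square integrable. -/
lemma weightForm_one_mem_d₀_domain (hΦ : ContDiff ℝ 2 Φ) {ψ : E n → ℝ} (hψ : ContDiff ℝ ∞ ψ)
    (hs : HasCompactSupport ψ) :
    weightForm hΦ.continuous hψ.continuous hs (1 : ℂ) ∈ (d₀ Φ hΦ.continuous).domain := by
  have h1 : ContDiff ℝ 1 fun x => ((ψ x * Real.exp (Φ x) : ℝ) : ℂ) • (1 : ℂ) :=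
    (Complex.ofRealCLM.contDiff.comp (contDiff_weight hΦ hψ)).smul contDiff_const
  have h2 : HasCompactSupport fun x => ((ψ x * Real.exp (Φ x) : ℝ) : ℂ) • (1 : ℂ) := by
    refine HasCompactSupport.intro hs.isCompact fun x hx => ?_
    rw [image_eq_zero_of_notMem_tsupport hx]
    simp
  exact mem_d₀_domain _ (toLp_mem_d₀Graph hΦ.continuous
    (memLp_weight_smul hΦ.continuous hψ.continuous hs (1 : ℂ)) (memLp_cgrad hΦ.continuous h1 h2)
    (isWeakGrad_cgrad h1))

/-- A `u` orthogonal to the domain is orthogonal to every `ψ e^Φ`, so it pairs to zero with every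
test function. -/
lemma dense_d₀_domain (hΦ : ContDiff ℝ 2 Φ) :
    Dense ((d₀ Φ hΦ.continuous).domain : Set (Forms₀ Φ)) := by
  rw [Submodule.dense_iff_topologicalClosure_eq_top, Submodule.topologicalClosure_eq_top_iff,
    Submodule.eq_bot_iff]
  intro u hu
  rw [Lp.eq_zero_iff_ae_eq_zero]
  refine (withDensity_absolutelyContinuous _ _).ae_le
    (ae_eq_zero_of_integral_contDiff_smul_eq_zero (locallyIntegrable_coeFn hΦ.continuous u)
      fun ψ hψ hs => ?_)
  have h1 := (Submodule.mem_orthogonal _ _).1 hu _ (weightForm_one_mem_d₀_domain hΦ hψ hs)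
  rwa [inner_weightForm_one] at h1

/-- The definition of the weak derivative says precisely that `d₀*` maps `ψ e^Φ dz^j` to `-(∂_j ψ)
e^Φ`. -/
lemma weightForm_single_mem_adjoint_domain (hΦ : ContDiff ℝ 2 Φ) {ψ : E n → ℝ}
    (hψ : ContDiff ℝ ∞ ψ) (hs : HasCompactSupport ψ) (j : Fin n) :
    weightForm hΦ.continuous hψ.continuous hs (EuclideanSpace.single j (1 : ℂ)) ∈
      (d₀ Φ hΦ.continuous)†.domain := by
  refine LinearPMap.mem_adjoint_domain_of_exists _ ⟨-weightForm hΦ.continuous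
    (continuous_partialDeriv hψ j) (hasCompactSupport_partialDeriv hs j) (1 : ℂ), fun u => ?_⟩
  have h1 := d₀_mem_graph hΦ.continuous u j ψ hψ hs
  rw [inner_neg_left, inner_weightForm_one, inner_weightForm_single, neg_eq_iff_eq_neg]
  exact h1

lemma weightForm_single_mem_d₁_domain (hΦ : ContDiff ℝ 2 Φ) {ψ : E n → ℝ}
    (hψ : ContDiff ℝ ∞ ψ) (hs : HasCompactSupport ψ) (j : Fin n) :
    weightForm hΦ.continuous hψ.continuous hs (EuclideanSpace.single j (1 : ℂ)) ∈
      (d₁ Φ hΦ.continuous).domain := by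
  have hloc := isLocallyFiniteMeasure_gibbs hΦ.continuous
  let ρ : E n → ℝ := fun x => ψ x * Real.exp (Φ x)
  let v : Fin n → E n → ℂ := fun l x => ((ρ x : ℝ) : ℂ) * (EuclideanSpace.single j (1 : ℂ)) l
  have hv : ∀ l, ContDiff ℝ 1 (v l) := fun l =>
    (Complex.ofRealCLM.contDiff.comp (contDiff_weight hΦ hψ)).mul contDiff_const
  have hvs : ∀ l, HasCompactSupport (v l) := fun l => by
    refine HasCompactSupport.intro hs.isCompact fun x hx => ?_
    simp [v, ρ, image_eq_zero_of_notMem_tsupport hx]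
  let D : Fin n → Fin n → E n → ℂ := fun k l x => fderiv ℝ (v l) x (EuclideanSpace.single k 1)
  have hD : ∀ k l, Continuous (D k l) := fun k l => continuous_fderiv_apply (hv l) _
  have hDs : ∀ k l x, x ∉ tsupport ψ → D k l x = 0 := fun k l x hx => by
    have h1 : tsupport (v l) ⊆ tsupport ψ := by
      refine closure_minimal (fun y hy => ?_) (isClosed_tsupport ψ)
      by_contra h
      exact hy (by simp [v, ρ, image_eq_zero_of_notMem_tsupport h])
    have h2 : fderiv ℝ (v l) x = 0 := image_eq_zero_of_notMem_tsupport
      fun h => hx (h1 (tsupport_fderiv_subset ℝ h))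
    simp only [D, h2]
    rfl
  let w : E n → EuclideanSpace ℂ {p : Fin n × Fin n // p.1 < p.2} := fun x =>
    WithLp.toLp 2 fun J => D J.1.1 J.1.2 x - D J.1.2 J.1.1 x
  have hw : Continuous w :=
    (PiLp.continuous_toLp 2 _).comp (continuous_pi fun J => (hD _ _).sub (hD _ _))
  have hws : HasCompactSupport w := by
    refine HasCompactSupport.intro hs.isCompact fun x hx => ?_
    ext J
    simp [w, hDs _ _ x hx]
  have hwm : MemLp w 2 (gibbs Φ) := hw.memLp_of_hasCompactSupport hws
  refine (exists_d₁_apply_eq hΦ.continuous (w := hwm.toLp w) ?_).choose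
  intro J φ hφ hφs
  have h1 : ∀ l k, pairing (fun x => (weightForm hΦ.continuous hψ.continuous hs
      (EuclideanSpace.single j (1 : ℂ)) : Forms₁ Φ) x l) (partialDeriv k φ) =
        -∫ x, φ x • D k l x := fun l k => by
    refine (pairing_toLp hΦ.continuous (memLp_weight_smul hΦ.continuous hψ.continuous hs
      (EuclideanSpace.single j (1 : ℂ))) (fun z => z l) (partialDeriv k φ)).trans ?_
    exact integral_partialDeriv_smul_eq hφ hφs (hv l) k
  have h2 := pairing_toLp hΦ.continuous hwm (fun z => z J) φ
  have hi : ∀ k l, Integrable (fun x => φ x • D k l x) volume := fun k l =>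
    (hφ.continuous.smul (hD k l)).integrable_of_hasCompactSupport hφs.smul_right
  refine (congrArg₂ (· - ·) (h1 J.1.2 J.1.1) (h1 J.1.1 J.1.2)).trans
    (Eq.trans ?_ (congrArg Neg.neg h2.symm))
  have h3 : pairing (fun x => w x J) φ =
      (∫ x, φ x • D J.1.1 J.1.2 x) - ∫ x, φ x • D J.1.2 J.1.1 x := by
    rw [← integral_sub (hi _ _) (hi _ _)]
    unfold pairing
    congr 1 with x
    rw [← smul_sub]
  rw [h3]
  ring

/-- The forms `ψ e^Φ dz^j` lie in both domains, and together they detect every coefficient. Density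
is what makes the operator `A₁` single-valued. -/
lemma dense_d₁_domain_inf_adjoint_domain (hΦ : ContDiff ℝ 2 Φ) :
    Dense (((d₁ Φ hΦ.continuous).domain ⊓ (d₀ Φ hΦ.continuous)†.domain :
      Submodule ℂ (Forms₁ Φ)) : Set (Forms₁ Φ)) := by
  rw [Submodule.dense_iff_topologicalClosure_eq_top, Submodule.topologicalClosure_eq_top_iff,
    Submodule.eq_bot_iff]
  intro v hv
  refine ae_zero_of_pairing hΦ.continuous v fun j ψ hψ hs => ?_
  have h1 := (Submodule.mem_orthogonal _ _).1 hv _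
    ⟨weightForm_single_mem_d₁_domain hΦ hψ hs j, weightForm_single_mem_adjoint_domain hΦ hψ hs j⟩
  rwa [inner_weightForm_single] at h1

lemma partialDeriv_comm {φ : E n → ℝ} (hφ : ContDiff ℝ ∞ φ) (j l : Fin n) :
    partialDeriv j (partialDeriv l φ) = partialDeriv l (partialDeriv j φ) := by
  ext x
  have hφ2 : ContDiff ℝ 2 φ := hφ.of_le (WithTop.coe_le_coe.2 (le_top : (2 : ℕ∞) ≤ ⊤))
  have h1 : ∀ k : Fin n, ∀ z : E n, fderiv ℝ (partialDeriv k φ) x z =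
      fderiv ℝ (fderiv ℝ φ) x z (EuclideanSpace.single k 1) := fun k z => by
    have h3 : DifferentiableAt ℝ (fderiv ℝ φ) x :=
      (hφ2.fderiv_right (m := 1) (by norm_num)).differentiable (by simp) x
    change fderiv ℝ (fun y => fderiv ℝ φ y _) x z = _
    rw [fderiv_clm_apply h3 (differentiableAt_const _)]
    simp
  have hsymm : IsSymmSndFDerivAt ℝ φ x := hφ2.contDiffAt.isSymmSndFDerivAt (by simp)
  unfold partialDeriv at h1 ⊢
  rw [h1, h1]
  exact hsymm _ _

lemma contDiff_partialDeriv {φ : E n → ℝ} (hφ : ContDiff ℝ ∞ φ) (j : Fin n) :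
    ContDiff ℝ ∞ (partialDeriv j φ) :=
  (hφ.fderiv_right (m := ∞) (by simp)).clm_apply contDiff_const

/-- Both derivatives are moved onto the test function, where they commute. -/
lemma d₁_comp_d₀ (hΦ : Continuous Φ) (u : (d₀ Φ hΦ).domain) :
    ∃ h : d₀ Φ hΦ u ∈ (d₁ Φ hΦ).domain, d₁ Φ hΦ ⟨d₀ Φ hΦ u, h⟩ = 0 := by
  refine exists_d₁_apply_eq hΦ fun J φ hφ hs => ?_
  have h1 : ∀ k l, pairing (fun x => (u : Forms₀ Φ) x) (partialDeriv l (partialDeriv k φ)) =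
      -pairing (fun x => d₀ Φ hΦ u x l) (partialDeriv k φ) := fun k l =>
    d₀_mem_graph hΦ u l _ (contDiff_partialDeriv hφ k) (hasCompactSupport_partialDeriv hs k)
  have h2 := pairing_zero hΦ (EuclideanSpace.proj J :
    EuclideanSpace ℂ {p : Fin n × Fin n // p.1 < p.2} →L[ℂ] ℂ) φ
  refine Eq.trans ?_ (congrArg Neg.neg h2.symm)
  have h3 := h1 J.1.1 J.1.2
  rw [partialDeriv_comm hφ, h1 J.1.2 J.1.1, neg_inj] at h3
  exact (sub_eq_zero.2 h3.symm).trans neg_zero.symm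

/-- Integrability need not be assumed: the integral of a nonintegrable function is `0` by
convention, hence not `1`. -/
lemma isProbabilityMeasure_gibbs (hμ : ∫ x, Real.exp (-Φ x) = 1) :
    IsProbabilityMeasure (gibbs Φ) := by
  have hi : Integrable (fun x => Real.exp (-Φ x)) volume := by
    by_contra h
    rw [integral_undef h] at hμ
    exact zero_ne_one hμ
  refine ⟨?_⟩
  rw [gibbs, withDensity_apply _ MeasurableSet.univ, Measure.restrict_univ,
    ← ofReal_integral_eq_lintegral_ofReal hi (ae_of_all _ fun x => (Real.exp_pos _).le), hμ,
    ENNReal.ofReal_one]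

end Concrete

/-! ### The Poincaré inequality on `H¹(μ)` -/

section Poincare

variable {n : ℕ} {Φ : E n → ℝ}

lemma norm_toLp_sq {F : Type*} [NormedAddCommGroup F] [InnerProductSpace ℂ F] {α : Type*}
    [MeasurableSpace α] {μ : Measure α} {f : α → F} (hf : MemLp f 2 μ) :
    ‖hf.toLp f‖ ^ 2 = ∫ x, ‖f x‖ ^ 2 ∂μ := by
  have h1 : (inner ℂ (hf.toLp f) (hf.toLp f) : ℂ) = ((∫ x, ‖f x‖ ^ 2 ∂μ : ℝ) : ℂ) := by
    rw [L2.inner_def, ← integral_complex_ofReal]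
    refine integral_congr_ae ?_
    filter_upwards [hf.coeFn_toLp] with x hx
    rw [hx, inner_self_eq_norm_sq_to_K]
    push_cast
    rfl
  rw [inner_self_eq_norm_sq_to_K] at h1
  exact Complex.ofReal_injective (by push_cast; exact h1)

/-- The Poincaré inequality on `H¹(μ)`, with the mean value over a ball as a remainder. -/
lemma exists_norm_sq_le_of_mem_d₀Graph (hΦ : ContDiff ℝ 2 Φ) [IsProbabilityMeasure (gibbs Φ)]
    {c : ℝ} (hc : 0 < c)
    (hinfty : ∀ᶠ x in Filter.cocompact (E n),
      c ≤ (1 / 2) * ‖gradient Φ x‖ ^ 2 - Laplacian.laplacian Φ x) :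
    ∃ R > 0, ∃ C ≥ 0, ∀ p ∈ d₀Graph Φ hΦ.continuous, ‖p.1‖ ^ 2 ≤ C * ‖p.2‖ ^ 2 +
      C * ‖inner ℂ (indicatorConstLp 2 (measurableSet_closedBall (x := (0 : E n)) (ε := R))
        (measure_ne_top (gibbs Φ) _) (1 : ℂ)) p.1‖ ^ 2 := by
  obtain ⟨R, hR, C, hC, hP⟩ := exists_integral_norm_sq_le hΦ hc hinfty
  refine ⟨R, hR, C, hC, fun p hp => ?_⟩
  set b := indicatorConstLp 2 (measurableSet_closedBall (x := (0 : E n)) (ε := R))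
        (measure_ne_top (gibbs Φ) _) (1 : ℂ) with hb
  -- Both sides are continuous in the `L²` norms of the pair; the remainder is the inner product
  -- with the indicator `b` of the ball. So the inequality passes from test functions to their
  -- limits.
  have hclosed : IsClosed {p : Forms₀ Φ × Forms₁ Φ |
      ‖p.1‖ ^ 2 ≤ C * ‖p.2‖ ^ 2 + C * ‖inner ℂ b p.1‖ ^ 2} :=
    isClosed_le (by fun_prop) (by fun_prop)
  have hmem : p ∈ closure {p : Forms₀ Φ × Forms₁ Φ |
      ‖p.1‖ ^ 2 ≤ C * ‖p.2‖ ^ 2 + C * ‖inner ℂ b p.1‖ ^ 2} := by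
    rw [EMetric.mem_closure_iff]
    intro ε hε
    obtain ⟨ε', hε'0, hε'⟩ := exists_between hε
    obtain ⟨f, hf, hfs, h1, h2⟩ := exists_smooth_approx hΦ.continuous (u := p.1) (v := p.2) hp
      (Lp.memLp p.1) (Lp.memLp p.2) (locallyIntegrable_coeFn hΦ.continuous p.1)
      (locallyIntegrable_coeFn hΦ.continuous p.2) hε'0.ne'
    have hf1 : ContDiff ℝ 1 f := hf.of_le (by simp)
    have hfm : MemLp f 2 (gibbs Φ) := hf.continuous.memLp_of_hasCompactSupport hfs
    have hgm : MemLp (cgrad f) 2 (gibbs Φ) := memLp_cgrad hΦ.continuous hf1 hfs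
    refine ⟨(hfm.toLp f, hgm.toLp (cgrad f)), ?_, ?_⟩
    · have h3 : inner ℂ b (hfm.toLp f) =
          ∫ x in Metric.closedBall (0 : E n) R, f x ∂(gibbs Φ) := by
        rw [hb, L2.inner_indicatorConstLp_one]
        refine integral_congr_ae (ae_restrict_of_ae ?_)
        filter_upwards [hfm.coeFn_toLp] with x hx using hx
      change ‖hfm.toLp f‖ ^ 2 ≤ C * ‖hgm.toLp (cgrad f)‖ ^ 2 + C * ‖inner ℂ b (hfm.toLp f)‖ ^ 2
      rw [norm_toLp_sq, norm_toLp_sq, h3]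
      exact hP f hf1 hfs
    · refine lt_of_le_of_lt ?_ hε'
      rw [edist_comm, Prod.edist_eq]
      refine max_le ?_ ?_
      · rw [Lp.edist_def]
        refine le_trans (le_of_eq (eLpNorm_congr_ae ?_)) h1
        filter_upwards [hfm.coeFn_toLp] with x hx
        simp only [Pi.sub_apply, hx]
      · rw [Lp.edist_def]
        refine le_trans (le_of_eq (eLpNorm_congr_ae ?_)) h2
        filter_upwards [hgm.coeFn_toLp] with x hx
        simp only [Pi.sub_apply, hx]
  exact hclosed.closure_subset hmem

/-- The constant function `1` in `L²(μ)`. -/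
def oneForm (Φ : E n → ℝ) [IsProbabilityMeasure (gibbs Φ)] : Forms₀ Φ :=
  (memLp_const (1 : ℂ)).toLp fun _ => 1

variable [IsProbabilityMeasure (gibbs Φ)]

lemma coeFn_oneForm : (oneForm Φ : E n → ℂ) =ᵐ[gibbs Φ] fun _ => 1 :=
  (memLp_const (1 : ℂ)).coeFn_toLp

lemma norm_oneForm : ‖oneForm Φ‖ = 1 := by
  have h : ‖oneForm Φ‖ ^ 2 = 1 := by rw [oneForm, norm_toLp_sq]; simp
  exact (pow_eq_one_iff_of_nonneg (norm_nonneg _) two_ne_zero).1 h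

lemma oneForm_mem_d₀Graph (hΦ : Continuous Φ) : (oneForm Φ, (0 : Forms₁ Φ)) ∈ d₀Graph Φ hΦ := by
  have h : IsWeakGrad (fun _ : E n => (1 : ℂ)) (fun _ => (0 : EuclideanSpace ℂ (Fin n))) := by
    have h1 := isWeakGrad_cgrad (n := n) (f := fun _ => 1) contDiff_const
    convert h1 using 1
    ext x j
    simp [cgrad]
  exact toLp_mem_d₀Graph hΦ (memLp_const 1) MemLp.zero h

lemma inner_oneForm (u : Forms₀ Φ) : inner ℂ (oneForm Φ) u = mean Φ u := by
  rw [L2.inner_def, mean]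
  refine integral_congr_ae ?_
  filter_upwards [coeFn_oneForm] with x hx
  simp [hx]

lemma inner_oneForm_self : inner ℂ (oneForm Φ) (oneForm Φ) = (1 : ℂ) := by
  rw [inner_self_eq_norm_sq_to_K, norm_oneForm]
  simp

/-- Centring `g₂` as well changes nothing, since the centred `g₁` is orthogonal to constants. -/
lemma cov_eq_inner (g₁ g₂ : Forms₀ Φ) :
    cov Φ g₁ g₂ = inner ℂ g₂ (g₁ - inner ℂ (oneForm Φ) g₁ • oneForm Φ) := by
  have h1 : inner ℂ (oneForm Φ) (g₁ - inner ℂ (oneForm Φ) g₁ • oneForm Φ) = (0 : ℂ) := by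
    rw [inner_sub_right, inner_smul_right, inner_oneForm_self, mul_one, sub_self]
  have h2 : inner ℂ g₂ (g₁ - inner ℂ (oneForm Φ) g₁ • oneForm Φ) =
      inner ℂ (g₂ - inner ℂ (oneForm Φ) g₂ • oneForm Φ)
        (g₁ - inner ℂ (oneForm Φ) g₁ • oneForm Φ) := by
    rw [inner_sub_left g₂, inner_smul_left, h1, mul_zero, sub_zero]
  have h3 : ∀ g : Forms₀ Φ, (g - inner ℂ (oneForm Φ) g • oneForm Φ : Forms₀ Φ) =ᵐ[gibbs Φ]
      fun x => g x - mean Φ g := fun g => by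
    filter_upwards [Lp.coeFn_sub g (inner ℂ (oneForm Φ) g • oneForm Φ),
      Lp.coeFn_smul (inner ℂ (oneForm Φ) g) (oneForm Φ), coeFn_oneForm] with x hx1 hx2 hx3
    rw [hx1, Pi.sub_apply, hx2, Pi.smul_apply, hx3, inner_oneForm, smul_eq_mul, mul_one]
  rw [h2, L2.inner_def, cov]
  refine integral_congr_ae ?_
  filter_upwards [h3 g₁, h3 g₂] with x hx1 hx2
  rw [hx1, hx2]
  rfl

/-- The Poincaré inequality on `H¹(μ)`. -/
theorem exists_poincare (hΦ : ContDiff ℝ 2 Φ) {c : ℝ} (hc : 0 < c)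
    (hinfty : ∀ᶠ x in Filter.cocompact (E n),
      c ≤ (1 / 2) * ‖gradient Φ x‖ ^ 2 - Laplacian.laplacian Φ x) :
    ∃ C : ℝ, ∀ u : (d₀ Φ hΦ.continuous).domain,
      ‖(u : Forms₀ Φ) - inner ℂ (oneForm Φ) (u : Forms₀ Φ) • oneForm Φ‖ ≤
        C * ‖d₀ Φ hΦ.continuous u‖ := by
  obtain ⟨R, hR, C, hC, hP⟩ := exists_norm_sq_le_of_mem_d₀Graph hΦ hc hinfty
  set b := indicatorConstLp 2 (measurableSet_closedBall (x := (0 : E n)) (ε := R))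
        (measure_ne_top (gibbs Φ) _) (1 : ℂ) with hb
  have hb1 : inner ℂ b (oneForm Φ) ≠ (0 : ℂ) := by
    rw [hb, L2.inner_indicatorConstLp_one, setIntegral_congr_ae (g := fun _ => (1 : ℂ))
      measurableSet_closedBall (coeFn_oneForm.mono fun x hx _ => hx), setIntegral_const]
    simpa using (measureReal_closedBall_gibbs_pos hΦ.continuous hR).ne'
  refine ⟨Real.sqrt C, fun u => ?_⟩
  -- The constant for which `u - m` has integral zero over the ball, so that the remainder vanishes;
  -- `d₀` does not see it.
  set m := inner ℂ b (u : Forms₀ Φ) / inner ℂ b (oneForm Φ) with hm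
  have h1 := (d₀Graph Φ hΦ.continuous).sub_mem (d₀_mem_graph hΦ.continuous u)
    ((d₀Graph Φ hΦ.continuous).smul_mem m (oneForm_mem_d₀Graph hΦ.continuous))
  have h2 := hP _ h1
  simp only [Prod.fst_sub, Prod.snd_sub, Prod.smul_fst, Prod.smul_snd, smul_zero, sub_zero] at h2
  rw [inner_sub_right, inner_smul_right, hm, div_mul_cancel₀ _ hb1, sub_self, norm_zero,
    zero_pow two_ne_zero, mul_zero, add_zero, ← hm] at h2
  set a := (u : Forms₀ Φ) - inner ℂ (oneForm Φ) (u : Forms₀ Φ) • oneForm Φ with ha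
  have h3 : inner ℂ (oneForm Φ) a = (0 : ℂ) := by
    rw [ha, inner_sub_right, inner_smul_right, inner_oneForm_self, mul_one, sub_self]
  have h4 : (u : Forms₀ Φ) - m • oneForm Φ =
      a + (inner ℂ (oneForm Φ) (u : Forms₀ Φ) - m) • oneForm Φ := by
    rw [ha, sub_smul]; abel
  -- By Pythagoras, among all constants the mean is the closest to `u`, so `m` may be replaced by
  -- it.
  have h5 : ‖a‖ ^ 2 ≤ ‖(u : Forms₀ Φ) - m • oneForm Φ‖ ^ 2 := by
    have h6 := norm_add_sq_eq_norm_sq_add_norm_sq_of_inner_eq_zero a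
      ((inner ℂ (oneForm Φ) (u : Forms₀ Φ) - m) • oneForm Φ) (𝕜 := ℂ)
      (by rw [inner_smul_right, inner_eq_zero_symm.1 h3, mul_zero])
    rw [h4]
    nlinarith [norm_nonneg ((inner ℂ (oneForm Φ) (u : Forms₀ Φ) - m) • oneForm Φ)]
  refine abs_le_of_sq_le_sq' ?_ (by positivity) |>.2
  rw [mul_pow, Real.sq_sqrt hC]
  exact h5.trans h2

end Poincare

end WittenComplex

end

theorem proposition5p1 (n : ℕ) (Φ : EuclideanSpace ℝ (Fin n) → ℝ)
    (hΦ : ContDiff ℝ 2 Φ)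
    (hμ : ∫ x, Real.exp (-Φ x) = 1)
    (c : ℝ) (hc : 0 < c)
    (hinfty : ∀ᶠ x in Filter.cocompact (EuclideanSpace ℝ (Fin n)),
      c ≤ (1 / 2) * ‖gradient Φ x‖ ^ 2 - Laplacian.laplacian Φ x) :
    -- `0` is not in the essential spectrum of `A₀`
    (0 : ℂ) ∉ WittenComplex.essentialSpectrum (WittenComplex.A₀ Φ hΦ.continuous) ∧
    -- `A₀` has closed range
    IsClosed (LinearMap.range (WittenComplex.A₀ Φ hΦ.continuous).toFun :
      Set (WittenComplex.Forms₀ Φ)) ∧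
    -- `A₁` is injective on `X₁`, so that its inverse is defined there
    LinearMap.ker (WittenComplex.A₁X Φ hΦ.continuous).toFun = ⊥ ∧
    -- for `g₁, g₂` in `H¹(μ)` the form `d g₁` is in the domain of the inverse of `A₁` on `X₁`,
    -- and `cov(g₁, g₂) = (A₁⁻¹ d g₁ | d g₂)_μ`
    ∀ g₁ g₂ : (WittenComplex.d₀ Φ hΦ.continuous).domain,
      ∃ h : WittenComplex.d₀ Φ hΦ.continuous g₁ ∈
          (WittenComplex.A₁X Φ hΦ.continuous).inverse.domain,
        WittenComplex.cov Φ (g₁ : WittenComplex.Forms₀ Φ) (g₂ : WittenComplex.Forms₀ Φ) =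
          inner ℂ (WittenComplex.d₀ Φ hΦ.continuous g₂)
            ((WittenComplex.A₁X Φ hΦ.continuous).inverse
              ⟨WittenComplex.d₀ Φ hΦ.continuous g₁, h⟩) := by
  
  have := WittenComplex.isProbabilityMeasure_gibbs hμ
  have hd := WittenComplex.dense_d₀_domain hΦ
  have hcl := WittenComplex.isClosed_d₀_graph hΦ.continuous
  have h1 := WittenComplex.norm_oneForm (Φ := Φ)
  have h0 := WittenComplex.oneForm_mem_d₀Graph hΦ.continuous
  rw [← WittenComplex.d₀_graph] at h0
  have hV := WittenComplex.dense_d₁_domain_inf_adjoint_domain hΦ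
  obtain ⟨C, hC⟩ := WittenComplex.exists_poincare hΦ hc hinfty
  refine ⟨WittenComplex.zero_notMem_essentialSpectrum_energyOperator hd hcl h1 h0 C hC,
    WittenComplex.isClosed_range_energyOperator hd hcl h1 h0 C hC,
    WittenComplex.ker_domRestrict_pairOperator hd hV, fun g₁ g₂ => ?_⟩
  rw [WittenComplex.cov_eq_inner]
  exact WittenComplex.inner_inverse_pairOperator hd hcl h1 h0 C hC hV
    (WittenComplex.d₁_comp_d₀ hΦ.continuous) g₁ g₂
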